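/- **Exotic forests.** An exotic (aromatic) forest $\pi$ is a finite directed graph in which every vertex has at most one outgoing edge, together with a set of pairwise disjoint two-element sets of vertices, called lianas. Vertices that lie in a liana are called grafted, the others black, and no edge ends in a grafted vertex. A root is a vertex without outgoing edge; connected components without a root contain a cycle and are called aromas. Unless it is empty, $\pi$ is required to have at least one root. Forests are taken up to isomorphism; $EF$ is the set of exotic forests, $\mathcal{EF}$ the real vector space spanned by it, $\cdot$ the concatenation (disjoint union), with unit the empty forest $\mathbf 1$, and $\sigma(\pi)$ the number of automorphisms of $\pi$ (preserving edges and lianas). A character of $(\mathcal{EF},\cdot)$ is given by a map $a:EF\to\mathbb R$ with $a(\mathbf 1)=1$ and $a(\pi_1\cdot\pi_2)=a(\pi_1)a(\pi_2)$, for example the coefficient map of a stochastic Runge–Kutta method. A labelled exotic forest is one whose vertices are distinct natural numbers. **Algorithm.** For every labelled forest fix a total order on its vertices such that (i) the order on a concatenation restricts to the given order on each factor, and (ii) the order does not depend on the labels: two labelled forests that are isomorphic as exotic forests are isomorphic as exotic forests with ordered vertices. A liana $\{v_1,v_2\}$ is connecting if $v_1$ and $v_2$ lie in different connected components of the graph.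 The minimal connecting liana is the one with an end $v_1$ of the shortest path to its root (a vertex in an aroma has no such path and comes after all vertices that have one; among vertices in aromas the length of the path to the cycle is compared), ties being resolved by the total order. To a forest with minimal connecting liana $\{v_1,v_2\}$ the algorithm applies: * if $v_1$ is not a root, ELI: with $b$ the end of the edge starting at $v_1$, $v_1$ takes the place of $b$ (it is attached to the vertex to which $b$ was attached, or becomes a root if $b$ was one), $b$ with everything attached to it takes the place of $v_2$, and $v_2$ is attached to $b$; * if $v_1$ is a root, every one of the transformations $IBP_v$ (an edge from $v_1$ to the black vertex $v$ is added), for all black vertices $v$, and $IBP_\bullet$ ($v_1$ is removed and $v_2$ becomes black). This is repeated until there is no connecting liana left. Each sequence of transformations so obtained, leading from $\pi$ to $\hat\pi$, is a transformation chain, with coefficient $C(\pi\to\hat\pi)=(-1)^p(-2)^q$, where $p$ is the number of its steps $IBP_v$ and $q$ that of its steps $IBP_\bullet$. Let $A_L(\pi)=\sum_{\pi\to\hat\pi}C(\pi\to\hat\pi)\,\hat\pi$, let $\Psi$ choose labels for each exotic forest, let $\Phi$ forget the labels, and let $A=\Phi\circ A_L\circ\Psi$. **Theorem 2.** Let $a:EF\to\mathbb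 R$ be a character of $(\mathcal{EF},\cdot)$, let $\delta_\sigma(a)=\sum_{\pi\in EF}\frac{a(\pi)}{\sigma(\pi)}\pi$, and let $$\omega(\pi)=\langle (A\circ\delta_\sigma)(a),\pi\rangle_\sigma ,$$ that is, $\sigma(\pi)$ times the coefficient of $\pi$ in $A(\delta_\sigma(a))$. Then every labelled exotic forest is the start of only finitely many chains, for each $\pi$ only finitely many $\pi_0\in EF$ have a nonzero coefficient of $\pi$ in $A(\pi_0)$, and $\omega$ is a character of $(\mathcal{EF},\cdot)$: $\omega(\mathbf 1)=1$ and $$\omega(\pi_1\cdot\pi_2)=\omega(\pi_1)\,\omega(\pi_2)\qquad\text{for all }\pi_1,\pi_2 .$$ Consequently the order condition $\omega(\pi_1\cdot\pi_2)=0$ holds as soon as $\omega(\pi_1)=0$ or $\omega(\pi_2)=0$. -/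

import Mathlib

/-!  Exotic aromatic forests, order-condition map of the ELI/IBP algorithm. -/

/-- A labelled exotic (aromatic) forest. The vertices are the finitely many labels in `verts`.
Every vertex has at most one outgoing edge, `v → w` if `parent v = some w`; the roots are the
vertices without outgoing edge, and a connected component without root contains a directed cycle
(it is an aroma). `mate` is the pairing of the grafted vertices into lianas: `v` is black if
`mate v = none` and grafted otherwise. No edge points to a grafted vertex. -/
@[ext]
structure LabForest where
  verts : Finset ℕ
  parent : ℕ → Option ℕ
  mate : ℕ → Option ℕ
  parent_mem : ∀ v w, parent v = some w → v ∈ verts ∧ w ∈ verts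
  parent_black : ∀ v w, parent v = some w → mate w = none
  mate_mem : ∀ v w, mate v = some w → v ∈ verts
  mate_symm : ∀ v w, mate v = some w → mate w = some v
  mate_ne : ∀ v, mate v ≠ some v

namespace LabForest

/-- `f` is empty or has at least one root. -/
def Rooted (f : LabForest) : Prop :=
  f.verts.Nonempty → ∃ v ∈ f.verts, f.parent v = none

/-- A bijection of the vertices that respects edges and lianas (hence also the two colours). -/
def IsIso (f g : LabForest) (φ : f.verts ≃ g.verts) : Prop :=
  ∀ v w : f.verts,
    (f.parent v = some (w : ℕ) ↔ g.parent (φ v) = some (φ w : ℕ)) ∧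
    (f.mate v = some (w : ℕ) ↔ g.mate (φ v) = some (φ w : ℕ))

/-- The group of automorphisms of `f`, labels disregarded. -/
def Aut (f : LabForest) : Type := {φ : f.verts ≃ f.verts // IsIso f f φ}

/-- The empty forest. -/
def empty : LabForest where
  verts := ∅
  parent _ := none
  mate _ := none
  parent_mem := by simp
  parent_black := by simp
  mate_mem := by simp
  mate_symm := by simp
  mate_ne := by simp

/-- Concatenation (disjoint union) of two labelled forests without common label. -/
def concat (f g : LabForest) (h : Disjoint f.verts g.verts) : LabForest where
  verts := f.verts ∪ g.verts
  parent v := if v ∈ f.verts then f.parent v else g.parent v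
  mate v := if v ∈ f.verts then f.mate v else g.mate v
  parent_mem := by
    intro v w
    have := f.parent_mem v w
    have := g.parent_mem v w
    simp only [Finset.mem_union]
    split_ifs <;> tauto
  parent_black := by
    intro v w
    have h1 := f.parent_mem v w
    have h2 := g.parent_mem v w
    have h3 := f.parent_black v w
    have h4 := g.parent_black v w
    have h5 : w ∈ f.verts → w ∉ g.verts := fun a b => Finset.disjoint_left.1 h a b
    split_ifs <;> tauto
  mate_mem := by
    intro v w
    have := f.mate_mem v w
    have := g.mate_mem v w
    simp only [Finset.mem_union]
    split_ifs <;> tauto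
  mate_symm := by
    intro v w
    have h1 := f.mate_symm v w
    have h2 := g.mate_symm v w
    have h3 := f.mate_mem w v
    have h4 := g.mate_mem w v
    have h5 : w ∈ f.verts → w ∉ g.verts := fun a b => Finset.disjoint_left.1 h a b
    split_ifs <;> tauto
  mate_ne := by
    intro v
    have := f.mate_ne v
    have := g.mate_ne v
    split_ifs <;> assumption

/-- Change of labels along an injection `e` of `ℕ` with left inverse `d`. -/
def relabel (e d : ℕ → ℕ) (h : ∀ n, d (e n) = n) (f : LabForest) : LabForest where
  verts := f.verts.image e
  parent n := if e (d n) = n then (f.parent (d n)).map e else none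
  mate n := if e (d n) = n then (f.mate (d n)).map e else none
  parent_mem := by
    intro v w
    split_ifs with hv
    · intro hw
      obtain ⟨u, hu, rfl⟩ := Option.map_eq_some_iff.1 hw
      obtain ⟨h1, h2⟩ := f.parent_mem _ _ hu
      exact ⟨Finset.mem_image.2 ⟨_, h1, hv⟩, Finset.mem_image_of_mem e h2⟩
    · simp
  parent_black := by
    intro v w
    split_ifs with hv hw hw
    · intro hw
      obtain ⟨u, hu, rfl⟩ := Option.map_eq_some_iff.1 hw
      simp [h, f.parent_black _ _ hu]
    all_goals simp
  mate_mem := by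
    intro v w
    split_ifs with hv
    · intro hw
      obtain ⟨u, hu, rfl⟩ := Option.map_eq_some_iff.1 hw
      exact Finset.mem_image.2 ⟨_, f.mate_mem _ _ hu, hv⟩
    · simp
  mate_symm := by
    intro v w
    split_ifs with hv hw hw
    · intro hw
      obtain ⟨u, hu, rfl⟩ := Option.map_eq_some_iff.1 hw
      simp [h, f.mate_symm _ _ hu, hv]
    · intro hw'
      obtain ⟨u, hu, rfl⟩ := Option.map_eq_some_iff.1 hw'
      simp [h] at hw
    all_goals simp
  mate_ne := by
    intro v
    split_ifs with hv
    · intro hw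
      obtain ⟨u, hu, hu'⟩ := Option.map_eq_some_iff.1 hw
      have : u = d v := by rw [← hu', h]
      exact f.mate_ne _ (this ▸ hu)
    · simp

lemma disjoint_relabel (f g : LabForest) :
    Disjoint (relabel (fun n => 2 * n) (fun n => n / 2) (fun n => by omega) f).verts
      (relabel (fun n => 2 * n + 1) (fun n => n / 2) (fun n => by omega) g).verts := by
  rw [Finset.disjoint_left]
  intro a ha hb
  obtain ⟨x, -, rfl⟩ := Finset.mem_image.1 ha
  obtain ⟨y, -, hy⟩ := Finset.mem_image.1 hb
  omega

/-- Concatenation of arbitrary labelled forests, made disjoint by even and odd labels. -/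
def sum (f g : LabForest) : LabForest :=
  concat _ _ (disjoint_relabel f g)

/-- `v` and `w` lie in the same connected component (lianas are not edges). -/
def SameComponent (f : LabForest) (v w : ℕ) : Prop :=
  Relation.EqvGen (fun a b => f.parent a = some b) v w

/-- `{v, w}` is a connecting liana. -/
def Connecting (f : LabForest) (v w : ℕ) : Prop :=
  f.mate v = some w ∧ ¬ f.SameComponent v w

/-- The vertex reached from `v` by following `k` edges, if there is one. -/
def ancestor (f : LabForest) (v k : ℕ) : Option ℕ :=
  (fun o : Option ℕ => o.bind f.parent)^[k] (some v)

open Classical in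
/-- `(0, k)` if the path from `v` to the root of its component has `k` edges; if `v` lies in an
aroma and so has no path to a root, `(1, k)` where `k` is the number of edges of the path from `v`
to the cycle of the aroma. Compared lexicographically. -/
noncomputable def depth (f : LabForest) (v : ℕ) : ℕ ×ₗ ℕ :=
  if ∃ k, f.ancestor v k = none then
    toLex (0, sInf {k | f.ancestor v (k + 1) = none})
  else
    toLex (1, sInf {k | ∃ m, 0 < m ∧ f.ancestor v (k + m) = f.ancestor v k})

/-- Edge-liana inversion for the liana `{v₁, v₂}`, moving `v₁` along the edge that starts at its
parent `b`: `v₁` takes the place of `b`, `b` (with all that is attached to it) takes the place of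
`v₂`, and `v₂` takes the place of `v₁`. -/
def eli (f : LabForest) (v₁ v₂ b : ℕ) (hm : f.mate v₁ = some v₂) (hb : f.parent v₁ = some b) :
    LabForest where
  verts := f.verts
  parent u := if u = v₁ then f.parent b else if u = b then f.parent v₂
    else if u = v₂ then some b else f.parent u
  mate := f.mate
  parent_mem := by
    intro u w
    have h1 := f.parent_mem v₁ b hb
    have h2 := f.mate_mem _ _ (f.mate_symm _ _ hm)
    split_ifs with c1 c2 c3
    · exact fun h => ⟨c1 ▸ h1.1, (f.parent_mem _ _ h).2⟩
    · exact fun h => ⟨c2 ▸ h1.2, (f.parent_mem _ _ h).2⟩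
    · exact fun h => ⟨c3 ▸ h2, Option.some.inj h ▸ h1.2⟩
    · exact f.parent_mem u w
  parent_black := by
    intro u w
    split_ifs with c1 c2 c3
    · exact f.parent_black _ _
    · exact f.parent_black _ _
    · exact fun h => Option.some.inj h ▸ f.parent_black _ _ hb
    · exact f.parent_black _ _
  mate_mem := f.mate_mem
  mate_symm := f.mate_symm
  mate_ne := f.mate_ne

/-- One term of integration by parts: an edge is drawn from `v₁` to the black vertex `v`. -/
def graft (f : LabForest) (v₁ v : ℕ) (h₁ : v₁ ∈ f.verts) (hv : v ∈ f.verts)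
    (hv' : f.mate v = none) : LabForest where
  verts := f.verts
  parent u := if u = v₁ then some v else f.parent u
  mate := f.mate
  parent_mem := by
    intro u w
    split_ifs with c1
    · exact fun h => ⟨c1 ▸ h₁, Option.some.inj h ▸ hv⟩
    · exact f.parent_mem u w
  parent_black := by
    intro u w
    split_ifs with c1
    · exact fun h => Option.some.inj h ▸ hv'
    · exact f.parent_black u w
  mate_mem := f.mate_mem
  mate_symm := f.mate_symm
  mate_ne := f.mate_ne

/-- The last term of integration by parts: `v₁` is removed and `v₂`, with which it forms a liana,
becomes black. -/
def blacken (f : LabForest) (v₁ v₂ : ℕ) (hm : f.mate v₁ = some v₂) : LabForest where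
  verts := f.verts.erase v₁
  parent u := if u = v₁ then none else f.parent u
  mate u := if u = v₁ ∨ u = v₂ then none else f.mate u
  parent_mem := by
    intro u w
    split_ifs with c1
    · simp
    · intro h
      have h1 := f.parent_mem u w h
      refine ⟨Finset.mem_erase.2 ⟨c1, h1.1⟩, Finset.mem_erase.2 ⟨?_, h1.2⟩⟩
      rintro rfl
      simp [f.parent_black _ _ h] at hm
  parent_black := by
    intro u w
    split_ifs with c1 c2 c2
    · simp
    · simp
    · simp
    · exact f.parent_black u w
  mate_mem := by
    intro u w
    split_ifs with c1
    · simp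
    · exact fun h => Finset.mem_erase.2 ⟨fun hu => c1 (Or.inl hu), f.mate_mem _ _ h⟩
  mate_symm := by
    intro u w
    split_ifs with c1 c2 c2
    · simp
    · simp
    · intro h
      have h' := f.mate_symm _ _ h
      rcases c2 with rfl | rfl
      · exact absurd (Or.inr (Option.some.inj (h'.symm.trans hm))) c1
      · exact absurd (Or.inl (Option.some.inj (h'.symm.trans (f.mate_symm _ _ hm)))) c1
    · exact f.mate_symm u w
  mate_ne := by
    intro u
    split_ifs with c1
    · simp
    · exact f.mate_ne u

lemma IsIso.refl (f : LabForest) : IsIso f f (Equiv.refl _) := fun _ _ => ⟨Iff.rfl, Iff.rfl⟩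

lemma IsIso.symm {f g : LabForest} {φ : f.verts ≃ g.verts} (h : IsIso f g φ) :
    IsIso g f φ.symm := by
  intro v w
  have := h (φ.symm v) (φ.symm w)
  simp only [Equiv.apply_symm_apply] at this
  exact ⟨this.1.symm, this.2.symm⟩

lemma IsIso.trans {f g k : LabForest} {φ : f.verts ≃ g.verts} {ψ : g.verts ≃ k.verts}
    (h : IsIso f g φ) (h' : IsIso g k ψ) : IsIso f k (φ.trans ψ) := fun v w =>
  ⟨(h v w).1.trans (h' (φ v) (φ w)).1, (h v w).2.trans (h' (φ v) (φ w)).2⟩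

lemma Rooted.empty : LabForest.empty.Rooted := fun h => by simp [LabForest.empty] at h

lemma Rooted.relabel {f : LabForest} (hf : f.Rooted) (e d : ℕ → ℕ) (h : ∀ n, d (e n) = n) :
    (f.relabel e d h).Rooted := by
  intro hn
  obtain ⟨v, hv, hv'⟩ := hf (Finset.image_nonempty.1 hn)
  exact ⟨e v, Finset.mem_image_of_mem e hv, by simp [LabForest.relabel, h, hv']⟩

lemma Rooted.concat {f g : LabForest} (hf : f.Rooted) (hg : g.Rooted)
    (h : Disjoint f.verts g.verts) : (f.concat g h).Rooted := by
  intro hn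
  rcases Finset.union_nonempty.1 hn with hn | hn
  · obtain ⟨v, hv, hv'⟩ := hf hn
    exact ⟨v, Finset.mem_union_left _ hv, by simp [LabForest.concat, hv, hv']⟩
  · obtain ⟨v, hv, hv'⟩ := hg hn
    exact ⟨v, Finset.mem_union_right _ hv, by
      simp [LabForest.concat, Finset.disjoint_right.1 h hv, hv']⟩

lemma exists_isIso_relabel (f : LabForest) (e d : ℕ → ℕ) (h : ∀ n, d (e n) = n) :
    ∃ φ, IsIso f (f.relabel e d h) φ := by
  have he : Function.Injective e := Function.LeftInverse.injective h
  let F : f.verts → (f.relabel e d h).verts := fun v => ⟨e v, Finset.mem_image_of_mem e v.2⟩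
  refine ⟨Equiv.ofBijective F ⟨?_, ?_⟩, ?_⟩
  · intro v w hvw
    exact Subtype.ext (he (Subtype.ext_iff.1 hvw))
  · rintro ⟨n, hn⟩
    obtain ⟨v, hv, rfl⟩ := Finset.mem_image.1 hn
    exact ⟨⟨v, hv⟩, rfl⟩
  · intro v w
    change (_ ↔ (f.relabel e d h).parent (e v) = some (e w)) ∧
      (_ ↔ (f.relabel e d h).mate (e v) = some (e w))
    simp [LabForest.relabel, h, he.eq_iff]

lemma exists_isIso_concat {f f' g g' : LabForest} (hf : ∃ φ, IsIso f f' φ)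
    (hg : ∃ φ, IsIso g g' φ) (h : Disjoint f.verts g.verts) (h' : Disjoint f'.verts g'.verts) :
    ∃ φ, IsIso (f.concat g h) (f'.concat g' h') φ := by
  obtain ⟨φ, hφ⟩ := hf
  obtain ⟨ψ, hψ⟩ := hg
  have key : ∀ {a b : LabForest} (hab : Disjoint a.verts b.verts) (v : (a.concat b hab).verts),
      (∃ x : a.verts, (x : ℕ) = v) ∨ ∃ x : b.verts, (x : ℕ) = v := by
    intro a b hab v
    rcases Finset.mem_union.1 v.2 with hv | hv
    · exact Or.inl ⟨⟨v, hv⟩, rfl⟩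
    · exact Or.inr ⟨⟨v, hv⟩, rfl⟩
  let F : (f.concat g h).verts → (f'.concat g' h').verts := fun v =>
    if hv : (v : ℕ) ∈ f.verts then ⟨φ ⟨v, hv⟩, Finset.mem_union_left _ (φ ⟨v, hv⟩).2⟩
    else
      have hv' : (v : ℕ) ∈ g.verts := (Finset.mem_union.1 v.2).resolve_left hv
      ⟨ψ ⟨v, hv'⟩, Finset.mem_union_right _ (ψ ⟨v, hv'⟩).2⟩
  have F1 : ∀ (x : f.verts) (v : (f.concat g h).verts), (x : ℕ) = v → (F v : ℕ) = φ x := by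
    rintro ⟨x, hx⟩ ⟨v, hv⟩ rfl
    simp [F, hx]
  have F2 : ∀ (x : g.verts) (v : (f.concat g h).verts), (x : ℕ) = v → (F v : ℕ) = ψ x := by
    rintro ⟨x, hx⟩ ⟨v, hv⟩ rfl
    simp [F, Finset.disjoint_right.1 h hx]
  have nf : ∀ (x : g.verts), (x : ℕ) ∉ f.verts := fun x => Finset.disjoint_right.1 h x.2
  have nf' : ∀ (x : g'.verts), (x : ℕ) ∉ f'.verts := fun x => Finset.disjoint_right.1 h' x.2
  refine ⟨Equiv.ofBijective F ⟨?_, ?_⟩, ?_⟩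
  · intro v w hvw
    have hvw' : (F v : ℕ) = F w := congrArg _ hvw
    apply Subtype.ext
    rcases key h v with ⟨x, hx⟩ | ⟨x, hx⟩ <;> rcases key h w with ⟨y, hy⟩ | ⟨y, hy⟩
    · rw [F1 x v hx, F1 y w hy] at hvw'
      rw [← hx, ← hy, φ.injective (Subtype.ext hvw')]
    · rw [F1 x v hx, F2 y w hy] at hvw'
      exact absurd (hvw' ▸ (φ x).2) (nf' _)
    · rw [F2 x v hx, F1 y w hy] at hvw'
      exact absurd (hvw'.symm ▸ (φ y).2) (nf' _)
    · rw [F2 x v hx, F2 y w hy] at hvw'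
      rw [← hx, ← hy, ψ.injective (Subtype.ext hvw')]
  · intro v
    rcases key h' v with ⟨x, hx⟩ | ⟨x, hx⟩
    · refine ⟨⟨φ.symm x, Finset.mem_union_left _ (φ.symm x).2⟩, Subtype.ext ?_⟩
      rw [F1 (φ.symm x) _ rfl, Equiv.apply_symm_apply, hx]
    · refine ⟨⟨ψ.symm x, Finset.mem_union_right _ (ψ.symm x).2⟩, Subtype.ext ?_⟩
      rw [F2 (ψ.symm x) _ rfl, Equiv.apply_symm_apply, hx]
  · intro v w
    change (_ ↔ (f'.concat g' h').parent (F v) = some (F w : ℕ)) ∧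
      (_ ↔ (f'.concat g' h').mate (F v) = some (F w : ℕ))
    have mm : ∀ a b, f.mate a = some b → b ∈ f.verts :=
      fun a b c => f.mate_mem _ _ (f.mate_symm _ _ c)
    have mm' : ∀ a b, f'.mate a = some b → b ∈ f'.verts :=
      fun a b c => f'.mate_mem _ _ (f'.mate_symm _ _ c)
    have nm : ∀ a b, g.mate a = some b → b ∈ g.verts :=
      fun a b c => g.mate_mem _ _ (g.mate_symm _ _ c)
    have nm' : ∀ a b, g'.mate a = some b → b ∈ g'.verts :=
      fun a b c => g'.mate_mem _ _ (g'.mate_symm _ _ c)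
    rcases key h v with ⟨x, hx⟩ | ⟨x, hx⟩ <;> rcases key h w with ⟨y, hy⟩ | ⟨y, hy⟩
    · rw [F1 x v hx, F1 y w hy, ← hx, ← hy]
      simpa [LabForest.concat] using hφ x y
    · rw [F1 x v hx, F2 y w hy, ← hx, ← hy]
      simp only [LabForest.concat, x.2, (φ x).2, if_true]
      exact ⟨⟨fun c => absurd (f.parent_mem _ _ c).2 (nf y),
        fun c => absurd (f'.parent_mem _ _ c).2 (nf' (ψ y))⟩,
        ⟨fun c => absurd (mm _ _ c) (nf y), fun c => absurd (mm' _ _ c) (nf' (ψ y))⟩⟩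
    · rw [F2 x v hx, F1 y w hy, ← hx, ← hy]
      simp only [LabForest.concat, nf x, nf' (ψ x), if_false]
      exact ⟨⟨fun c => absurd y.2 (Finset.disjoint_right.1 h (g.parent_mem _ _ c).2),
        fun c => absurd (φ y).2 (Finset.disjoint_right.1 h' (g'.parent_mem _ _ c).2)⟩,
        ⟨fun c => absurd y.2 (Finset.disjoint_right.1 h (nm _ _ c)),
        fun c => absurd (φ y).2 (Finset.disjoint_right.1 h' (nm' _ _ c))⟩⟩
    · rw [F2 x v hx, F2 y w hy, ← hx, ← hy]
      simpa [LabForest.concat, nf x, nf' (ψ x)] using hψ x y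

end LabForest

/-- The set of labelled exotic forests: empty or with at least one root. -/
def LabExoticForest : Type := {f : LabForest // f.Rooted}

/-- Two labelled exotic forests are equivalent if they differ only by the labels. -/
instance LabExoticForest.setoid : Setoid LabExoticForest where
  r f g := ∃ φ, LabForest.IsIso f.1 g.1 φ
  iseqv :=
    { refl := fun f => ⟨_, LabForest.IsIso.refl f.1⟩
      symm := fun ⟨_, h⟩ => ⟨_, h.symm⟩
      trans := fun ⟨_, h⟩ ⟨_, h'⟩ => ⟨_, h.trans h'⟩ }

/-- The set `EF` of exotic forests. -/
def ExoticForest : Type := Quotient LabExoticForest.setoid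

namespace ExoticForest

/-- The map that forgets the labels. -/
def forget (f : LabExoticForest) : ExoticForest := Quotient.mk _ f

/-- The empty forest. -/
instance : One ExoticForest := ⟨forget ⟨LabForest.empty, LabForest.Rooted.empty⟩⟩

/-- The concatenation product. -/
instance : Mul ExoticForest :=
  ⟨Quotient.map₂
    (fun f g => ⟨LabForest.sum f.1 g.1, (f.2.relabel _ _ _).concat (g.2.relabel _ _ _)
      (LabForest.disjoint_relabel f.1 g.1)⟩)
    (by
      have key : ∀ {a b : LabForest} (e d : ℕ → ℕ) (h : ∀ n, d (e n) = n),
          (∃ φ, LabForest.IsIso a b φ) →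
          ∃ φ, LabForest.IsIso (a.relabel e d h) (b.relabel e d h) φ := by
        rintro a b e d h ⟨φ, hφ⟩
        obtain ⟨α, hα⟩ := a.exists_isIso_relabel e d h
        obtain ⟨β, hβ⟩ := b.exists_isIso_relabel e d h
        exact ⟨_, (hα.symm.trans hφ).trans hβ⟩
      intro f f' hf g g' hg
      exact LabForest.exists_isIso_concat (key _ _ _ hf) (key _ _ _ hg)
        (LabForest.disjoint_relabel f.1 g.1) (LabForest.disjoint_relabel f'.1 g'.1))⟩

/-- The symmetry coefficient: the number of automorphisms. -/
noncomputable def symmetry (π : ExoticForest) : ℕ :=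
  Quotient.liftOn π (fun f => Nat.card f.1.Aut) (by
    rintro f g ⟨φ, hφ⟩
    refine Nat.card_congr
      { toFun := fun α => ⟨(φ.symm.trans α.1).trans φ, (hφ.symm.trans α.2).trans hφ⟩
        invFun := fun β => ⟨(φ.trans β.1).trans φ.symm, (hφ.trans β.2).trans hφ.symm⟩
        left_inv := fun α => Subtype.ext (by ext x; simp)
        right_inv := fun β => Subtype.ext (by ext x; simp) })

/-- `a` is a character of the concatenation algebra of exotic forests (given on the basis): it
sends the unit to `1` and is multiplicative. -/
structure IsCharacter (a : ExoticForest → ℝ) : Prop where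
  map_one : a 1 = 1
  map_mul : ∀ π₁ π₂ : ExoticForest, a (π₁ * π₂) = a π₁ * a π₂

end ExoticForest

/-- A choice of a total order `le f` on the vertices of every labelled forest `f` that respects
concatenation and that does not depend on the labels: if `f` and `g` differ only by their labels,
then so do the ordered forests `(f, le f)` and `(g, le g)`. (Vertices that an automorphism
exchanges may be ordered by their labels.) -/
structure VertexOrder where
  le : LabForest → ℕ → ℕ → Prop
  le_trans : ∀ f, ∀ u ∈ f.verts, ∀ v ∈ f.verts, ∀ w ∈ f.verts, le f u v → le f v w → le f u w
  le_antisymm : ∀ f, ∀ v ∈ f.verts, ∀ w ∈ f.verts, le f v w → le f w v → v = w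
  le_total : ∀ f, ∀ v ∈ f.verts, ∀ w ∈ f.verts, le f v w ∨ le f w v
  le_concat : ∀ (f g : LabForest) (h : Disjoint f.verts g.verts), f.Rooted → g.Rooted →
    ∀ v ∈ f.verts, ∀ w ∈ f.verts, (le (f.concat g h) v w ↔ le f v w)
  le_iso : ∀ f g : LabForest, f.Rooted → g.Rooted → (∃ φ, LabForest.IsIso f g φ) →
    ∃ φ : f.verts ≃ g.verts, LabForest.IsIso f g φ ∧
      ∀ v w : f.verts, le f v w ↔ le g (φ v) (φ w)

/-- `{v₁, v₂}` is the minimal connecting liana of `f`: the depth of `v₁` is smallest among the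
vertices of connecting lianas and, among those of this depth, `v₁` is first in the total order
(`v₂` is determined by `v₁`). -/
def VertexOrder.IsMinimal (O : VertexOrder) (f : LabForest) (v₁ v₂ : ℕ) : Prop :=
  f.Connecting v₁ v₂ ∧ ∀ w₁ w₂, f.Connecting w₁ w₂ →
    f.depth v₁ < f.depth w₁ ∨ (f.depth v₁ = f.depth w₁ ∧ O.le f v₁ w₁)

/-- `LTC O f g` is the set of labelled transformation chains from `f` to `g` generated by the
algorithm: it stops at a forest without connecting lianas; otherwise, with `{v₁, v₂}` the minimal
connecting liana, it applies ELI if `v₁` is not a root, and if `v₁` is a root it either grafts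
`v₁` onto some black vertex `v` (`IBP_v`) or removes `v₁` and makes `v₂` black (`IBP_•`). -/
inductive LTC (O : VertexOrder) : LabForest → LabForest → Type
  | done (f : LabForest) (h : ∀ v w, ¬ f.Connecting v w) : LTC O f f
  | eli {f g : LabForest} (v₁ v₂ b : ℕ) (h : O.IsMinimal f v₁ v₂) (hb : f.parent v₁ = some b)
      (c : LTC O (f.eli v₁ v₂ b h.1.1 hb) g) : LTC O f g
  | ibpVertex {f g : LabForest} (v₁ v₂ v : ℕ) (h : O.IsMinimal f v₁ v₂)
      (hr : f.parent v₁ = none) (hv : v ∈ f.verts) (hv' : f.mate v = none)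
      (c : LTC O (f.graft v₁ v (f.mate_mem _ _ h.1.1) hv hv') g) : LTC O f g
  | ibpBlack {f g : LabForest} (v₁ v₂ : ℕ) (h : O.IsMinimal f v₁ v₂) (hr : f.parent v₁ = none)
      (c : LTC O (f.blacken v₁ v₂ h.1.1) g) : LTC O f g

/-- The coefficient `C` of a chain: a factor `-1` for every `IBP_v`, `-2` for every `IBP_•`. -/
def LTC.coeff {O : VertexOrder} : {f g : LabForest} → LTC O f g → ℝ
  | _, _, .done _ _ => 1
  | _, _, .eli _ _ _ _ _ c => c.coeff
  | _, _, .ibpVertex _ _ _ _ _ _ _ c => (-1) * c.coeff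
  | _, _, .ibpBlack _ _ _ _ c => (-2) * c.coeff

namespace ExoticForest

/-- The coefficient of `g` in `A_L f`, the sum of `C(f → g) g` over all chains starting at `f`. -/
noncomputable def coeffAL (O : VertexOrder) (f g : LabExoticForest) : ℝ :=
  ∑ᶠ c : LTC O f.1 g.1, c.coeff

/-- The coefficient of `π` in `A π₀`, where `A = Φ ∘ A_L ∘ Ψ`, the map `Φ` forgets the labels and
`Ψ` chooses labels. -/
noncomputable def coeffA (O : VertexOrder) (Ψ : ExoticForest → LabExoticForest)
    (π₀ π : ExoticForest) : ℝ :=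
  ∑ᶠ g : {g : LabExoticForest // forget g = π}, coeffAL O (Ψ π₀) g.1

/-- The order-condition map `ω(π) = ⟨(A ∘ δ_σ)(a), π⟩_σ`, where `δ_σ(a)` is the formal sum of the
`(a(π₀) / σ(π₀)) π₀` and `⟨·, π⟩_σ` is `σ(π)` times the coefficient of `π`. -/
noncomputable def omega (O : VertexOrder) (Ψ : ExoticForest → LabExoticForest)
    (a : ExoticForest → ℝ) (π : ExoticForest) : ℝ :=
  (symmetry π : ℝ) * ∑ᶠ π₀ : ExoticForest, a π₀ / (symmetry π₀ : ℝ) * coeffA O Ψ π₀ π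

end ExoticForest

/-! Write `isoSum O p f` for the sum of `C(f → g)` over all chains from `f`, each end `g` weighted
by the number of isomorphisms from `p` to `g`. Since this number is `σ(p)` or `0`, the pairing in
`ω` becomes the sum of `a(π₀)/σ(π₀) * isoSum O p π₀` over all `π₀` (`symmetry_mul_coeffA`).

The heart is a coproduct formula: `isoSum O (p·q) f` is the sum, over all ways to split `f` into two
parts joined by no edge and no liana, of `isoSum O p` of one part times `isoSum O q` of the other.
At the end of a chain this only says that an isomorphism from `p·q` is a splitting of its target
with an isomorphism onto each part (`isoCard_concat`). It is carried back along the algorithm in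
`chainSum_eq_sum_splittings`: depth, connectedness and vertex order are read off inside a factor, so
a step acts on the factor that contains the minimal liana. ELI does not change the splittings, IBP_•
changes them only by the removed vertex, and IBP_v keeps exactly those with `v₁` and `v` on the same
side; after exchanging the sums, each splitting sees precisely the IBP of its own factor.
Multiplication by the character `a` preserves the formula (`omegaTerm_concat`).

By orbit counting, a sum over forests with weight `1/σ` is a sum over labelled forests on `n`
vertices with weight `1/n!` (`finsum_div_symmetry`), and under such weights the formula turns into a
Cauchy product (`egf_eq_sum_range`). This passage needs that the outcome is independent of the
labels (`chainSum_congr`).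

All inductions run along the algorithm (`algorithm_induction`). It terminates because the pair
(roots plus cyclic vertices, depth of the minimal liana) decreases lexicographically. The sums over
`π₀` are finite because every step preserves the number of vertices plus the number of black
vertices. -/

namespace LabForest

/-! ### Cycles, components and depth under an edge-liana inversion. -/

/-- There is an edge from `a` to `b`. -/
abbrev Edge (f : LabForest) (a b : ℕ) : Prop := f.parent a = some b

/-- `v` lies on a directed cycle. -/
abbrev Cyclic (f : LabForest) (v : ℕ) : Prop := Relation.TransGen f.Edge v v

lemma mem_of_mate {f : LabForest} {v w : ℕ} (h : f.mate v = some w) : w ∈ f.verts :=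
  f.mate_mem _ _ (f.mate_symm _ _ h)

lemma mate_eq_none_of_transGen {f : LabForest} {u w : ℕ} (h : Relation.TransGen f.Edge u w) :
    f.mate w = none := by
  cases h with
  | single h => exact f.parent_black _ _ h
  | tail _ h => exact f.parent_black _ _ h

lemma transGen_ne_of_mate {f : LabForest} {u w x y : ℕ} (h : Relation.TransGen f.Edge u w)
    (hm : f.mate x = some y) : w ≠ x := by
  rintro rfl
  simp [mate_eq_none_of_transGen h] at hm

lemma SameComponent.of_transGen {f : LabForest} {u w : ℕ} (h : Relation.TransGen f.Edge u w) :
    f.SameComponent u w := by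
  induction h with
  | single h => exact .rel _ _ h
  | tail _ h ih => exact .trans _ _ _ ih (.rel _ _ h)

/-- A set of vertices closed under edges in both directions is a union of components. -/
lemma SameComponent.mem_iff {f : LabForest} {S : Set ℕ}
    (hS : ∀ u w, f.parent u = some w → (u ∈ S ↔ w ∈ S)) {u w : ℕ} (h : f.SameComponent u w) :
    u ∈ S ↔ w ∈ S := by
  induction h with
  | rel _ _ h => exact hS _ _ h
  | refl => rfl
  | symm _ _ _ ih => exact ih.symm
  | trans _ _ _ _ _ ih ih' => exact ih.trans ih'

/-- Out-degree at most one forces a walk that starts on a cycle to stay on it. -/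
lemma Cyclic.reflTransGen_symm {f : LabForest} {u y : ℕ} (hu : f.Cyclic u)
    (h : Relation.ReflTransGen f.Edge u y) : Relation.ReflTransGen f.Edge y u := by
  induction h with
  | refl => exact .refl
  | @tail y z _ hyz ih =>
    have key : ∀ {y z}, f.Edge y z → Relation.TransGen f.Edge y u →
        Relation.ReflTransGen f.Edge z u := by
      intro y z hyz h
      obtain ⟨x, hx, hxu⟩ := Relation.TransGen.head'_iff.1 h
      obtain rfl : x = z := Option.some.inj (hx.symm.trans hyz)
      exact hxu
    rcases Relation.reflTransGen_iff_eq_or_transGen.1 ih with rfl | h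
    · exact key hyz hu
    · exact key hyz h

lemma Cyclic.of_transGen {f : LabForest} {u y : ℕ} (hu : f.Cyclic u)
    (h : Relation.TransGen f.Edge u y) : f.Cyclic y :=
  Relation.TransGen.trans_right (hu.reflTransGen_symm h.to_reflTransGen) h

section Eli

variable {f : LabForest} {v₁ v₂ b : ℕ} (hc : f.Connecting v₁ v₂) (hb : f.parent v₁ = some b)

include hc hb

lemma Connecting.ne_parent : b ≠ v₁ ∧ b ≠ v₂ := by
  have := f.parent_black _ _ hb
  constructor
  · rintro rfl; simp [hc.1] at this
  · rintro rfl; simp [f.mate_symm _ _ hc.1] at this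

lemma Connecting.not_sameComponent_parent : ¬ f.SameComponent b v₂ := fun h =>
  hc.2 (.trans _ _ _ (.rel _ _ hb) h)

omit hc in
lemma eli_parent_of_ne (hm : f.mate v₁ = some v₂) {u : ℕ} (h₁ : u ≠ v₁) (h₂ : u ≠ v₂)
    (h₃ : u ≠ b) : (f.eli v₁ v₂ b hm hb).parent u = f.parent u := by
  simp [eli, h₁, h₂, h₃]

/-- After the inversion, a walk from `b` runs through the old component of `v₂`. It cannot return to
`b`, which lay in another component, nor meet `v₁` or `v₂`, which are grafted and have no incoming
edge. -/
lemma not_cyclic_eli : ¬ (f.eli v₁ v₂ b hc.1 hb).Cyclic b := by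
  have key : ∀ y, Relation.TransGen (f.eli v₁ v₂ b hc.1 hb).Edge b y → f.SameComponent y v₂ := by
    intro y h
    induction h with
    | @single y h =>
      have h' : f.parent v₂ = some y := by
        simpa [eli, Edge, (hc.ne_parent hb).1] using h
      exact .symm _ _ (.rel _ _ h')
    | @tail y z hy h ih =>
      have h1 : y ≠ v₁ := transGen_ne_of_mate hy (y := v₂) hc.1
      have h2 : y ≠ v₂ := transGen_ne_of_mate hy (y := v₁) (f.mate_symm _ _ hc.1)
      have h3 : y ≠ b := by
        rintro rfl
        exact hc.not_sameComponent_parent hb ih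
      rw [Edge, eli_parent_of_ne hb hc.1 h1 h2 h3] at h
      exact .trans _ _ _ (.symm _ _ (.rel _ _ h)) ih
  exact fun h => hc.not_sameComponent_parent hb (key _ h)

/-- A new cycle avoids the grafted `v₁`, `v₂` and, by `not_cyclic_eli`, also `b`. These are the only
vertices whose outgoing edge changes, so all its edges are old. -/
lemma Cyclic.of_eli {u : ℕ} (hu : (f.eli v₁ v₂ b hc.1 hb).Cyclic u) : f.Cyclic u := by
  have step : ∀ y z, (f.eli v₁ v₂ b hc.1 hb).Cyclic y → (f.eli v₁ v₂ b hc.1 hb).Edge y z →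
      f.Edge y z := by
    intro y z hy h
    have h1 : y ≠ v₁ := transGen_ne_of_mate hy (y := v₂) hc.1
    have h2 : y ≠ v₂ := transGen_ne_of_mate hy (y := v₁) (f.mate_symm _ _ hc.1)
    have h3 : y ≠ b := by
      rintro rfl
      exact not_cyclic_eli hc hb hy
    rwa [Edge, eli_parent_of_ne hb hc.1 h1 h2 h3] at h
  have key : ∀ y, Relation.TransGen (f.eli v₁ v₂ b hc.1 hb).Edge u y →
      Relation.TransGen f.Edge u y := by
    intro y h
    induction h with
    | single h => exact .single (step _ _ hu h)
    | tail hy h ih => exact .tail ih (step _ _ (hu.of_transGen hy) h)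
  exact key _ hu

/-- If `b` were on a cycle, the walk from `v₁` would still run around to `b`, to which `v₂` is now
attached. Off cycles, the part above `b` stays behind with `v₁` while `b` moves to the side of `v₂`.
-/
lemma Connecting.eli (hcyc : ¬ f.Cyclic b) : (f.eli v₁ v₂ b hc.1 hb).Connecting v₁ v₂ := by
  refine ⟨hc.1, fun h => ?_⟩
  have hne := hc.ne_parent hb
  have h21 : v₂ ≠ v₁ := by
    rintro rfl
    exact f.mate_ne _ hc.1
  -- The old component of `b` without everything that leads into `b`, but with `v₁`. It is closed
  -- under the new edges and separates `v₁` from `v₂`.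
  let S : Set ℕ := {u | f.SameComponent u b ∧ (u = v₁ ∨ ¬ Relation.ReflTransGen f.Edge u b)}
  have hv₂ : ∀ u, f.SameComponent v₂ u → u ∉ S := fun u h hu =>
    hc.not_sameComponent_parent hb (.symm _ _ (.trans _ _ _ h hu.1))
  have hbS : b ∉ S := fun h => h.2.elim hne.1 fun h => h .refl
  have hS : ∀ u w, (f.eli v₁ v₂ b hc.1 hb).parent u = some w → (u ∈ S ↔ w ∈ S) := by
    intro u w huw
    by_cases c1 : u = v₁
    · subst c1
      have h' : f.parent b = some w := by simpa [LabForest.eli] using huw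
      refine iff_of_true ⟨.rel _ _ hb, Or.inl rfl⟩ ⟨.symm _ _ (.rel _ _ h'), Or.inr fun h => ?_⟩
      exact hcyc (Relation.TransGen.head' h' h)
    by_cases c2 : u = b
    · subst c2
      have h' : f.parent v₂ = some w := by simpa [LabForest.eli, c1] using huw
      exact iff_of_false hbS (hv₂ _ (.rel _ _ h'))
    by_cases c3 : u = v₂
    · subst c3
      have h' : b = w := by simpa [LabForest.eli, c1, c2] using huw
      exact iff_of_false (hv₂ _ (.refl _)) (h' ▸ hbS)
    rw [eli_parent_of_ne hb hc.1 c1 c3 c2] at huw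
    have hw : w ≠ v₁ := transGen_ne_of_mate (.single huw) hc.1
    have e1 : f.SameComponent u b ↔ f.SameComponent w b :=
      ⟨fun h => .trans _ _ _ (.symm _ _ (.rel _ _ huw)) h, fun h => .trans _ _ _ (.rel _ _ huw) h⟩
    have e2 : Relation.ReflTransGen f.Edge u b ↔ Relation.ReflTransGen f.Edge w b := by
      refine ⟨fun h => ?_, fun h => .head huw h⟩
      rcases Relation.ReflTransGen.cases_head h with rfl | ⟨x, hx, hxb⟩
      · exact absurd rfl c2
      · obtain rfl : x = w := Option.some.inj (hx.symm.trans huw)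
        exact hxb
    simp only [S, Set.mem_ofPred_eq, e1, e2, c1, hw, false_or]
  exact hv₂ _ (.refl _) ((h.mem_iff hS).1 ⟨.rel _ _ hb, Or.inl rfl⟩)

end Eli

lemma ancestor_zero (f : LabForest) (v : ℕ) : f.ancestor v 0 = some v := rfl

lemma ancestor_succ (f : LabForest) (v k : ℕ) :
    f.ancestor v (k + 1) = (f.ancestor v k).bind f.parent := by
  simp [ancestor, Function.iterate_succ_apply']

lemma ancestor_succ_of_parent {f : LabForest} {v b : ℕ} (h : f.parent v = some b) (k : ℕ) :
    f.ancestor v (k + 1) = f.ancestor b k := by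
  simp [ancestor, Function.iterate_succ_apply, h]

lemma transGen_of_ancestor {f : LabForest} {v y k : ℕ} (h : f.ancestor v (k + 1) = some y) :
    Relation.TransGen f.Edge v y := by
  induction k generalizing y with
  | zero => exact .single (by simpa [ancestor_succ, ancestor_zero] using h)
  | succ k ih =>
    rw [ancestor_succ] at h
    obtain ⟨x, hx, hxy⟩ := Option.bind_eq_some_iff.1 h
    exact .tail (ih hx) hxy

/-- The path from `v₁` skips `b` and is otherwise unchanged: beyond `b` it meets neither grafted
vertices nor, `b` being off cycles, `b` again. -/
lemma ancestor_eli {f : LabForest} {v₁ v₂ b : ℕ} (hc : f.Connecting v₁ v₂)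
    (hb : f.parent v₁ = some b) (hcyc : ¬ f.Cyclic b) (k : ℕ) :
    (f.eli v₁ v₂ b hc.1 hb).ancestor v₁ (k + 1) = f.ancestor v₁ (k + 2) := by
  rw [ancestor_succ_of_parent hb]
  induction k with
  | zero => simp [ancestor_succ, ancestor_zero, eli]
  | succ k ih =>
    rw [ancestor_succ, ih, ancestor_succ f b (k + 1)]
    cases h : f.ancestor b (k + 1) with
    | none => rfl
    | some y =>
      have ht := transGen_of_ancestor h
      exact eli_parent_of_ne hb hc.1 (transGen_ne_of_mate ht hc.1)
        (transGen_ne_of_mate ht (f.mate_symm _ _ hc.1)) (fun e => hcyc (e ▸ ht))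

/-- Pigeonhole. It guarantees that the infimum in the second case of `depth` is attained and is not
the default value of an empty set. -/
lemma exists_ancestor_periodic {f : LabForest} {v : ℕ} (h : ∀ k, f.ancestor v k ≠ none) :
    ∃ k m, 0 < m ∧ f.ancestor v (k + m) = f.ancestor v k := by
  have hmem : ∀ k, f.ancestor v (k + 1) ∈ f.verts.image some := by
    intro k
    obtain ⟨y, hy⟩ := Option.ne_none_iff_exists'.1 (h (k + 1))
    have := hy
    rw [ancestor_succ] at this
    obtain ⟨x, -, hx⟩ := Option.bind_eq_some_iff.1 this
    rw [hy]
    exact Finset.mem_image_of_mem _ (f.parent_mem _ _ hx).2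
  obtain ⟨i, j, hij, e⟩ := Finite.exists_ne_map_eq_of_infinite
    (fun k : ℕ => (⟨_, hmem k⟩ : (f.verts.image some : Finset (Option ℕ))))
  have e' := Subtype.ext_iff.1 e
  dsimp only at e'
  rcases lt_or_gt_of_ne hij with h | h
  · exact ⟨i + 1, j - i, by omega, by rw [show i + 1 + (j - i) = j + 1 by omega, e']⟩
  · exact ⟨j + 1, i - j, by omega, by rw [show j + 1 + (i - j) = i + 1 by omega, e']⟩

lemma depth_eli_lt {f : LabForest} {v₁ v₂ b : ℕ} (hc : f.Connecting v₁ v₂)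
    (hb : f.parent v₁ = some b) (hcyc : ¬ f.Cyclic b) :
    (f.eli v₁ v₂ b hc.1 hb).depth v₁ < f.depth v₁ := by
  have hanc := ancestor_eli hc hb hcyc
  have hone : f.ancestor v₁ 1 = some b := by rw [ancestor_succ_of_parent hb]; rfl
  unfold depth
  by_cases h : ∃ k, f.ancestor v₁ k = none
  · have hne : ({k | f.ancestor v₁ (k + 1) = none} : Set ℕ).Nonempty := by
      obtain ⟨k, hk⟩ := h
      exact ⟨k, by simp [ancestor_succ, hk]⟩
    have hmem := Nat.sInf_mem hne
    set s := sInf {k | f.ancestor v₁ (k + 1) = none}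
    obtain ⟨t, ht⟩ : ∃ t, s = t + 1 := by
      refine Nat.exists_eq_succ_of_ne_zero fun h0 => ?_
      rw [Set.mem_ofPred_eq, h0, zero_add, hone] at hmem
      cases hmem
    rw [Set.mem_ofPred_eq, ht, ← hanc] at hmem
    rw [if_pos h, if_pos ⟨_, hmem⟩, Prod.Lex.toLex_lt_toLex]
    exact Or.inr ⟨rfl, lt_of_le_of_lt (Nat.sInf_le hmem) (by omega)⟩
  · rw [if_neg h]
    push Not at h
    split_ifs with h'
    -- Any depth with a path to a root is below any depth in an aroma, so this case needs no closer
    -- look.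
    · exact Prod.Lex.toLex_lt_toLex.2 (Or.inl Nat.zero_lt_one)
    refine Prod.Lex.toLex_lt_toLex.2 (Or.inr ⟨rfl, ?_⟩)
    have hmem := Nat.sInf_mem (s := {k | ∃ m, 0 < m ∧ f.ancestor v₁ (k + m) = f.ancestor v₁ k})
      (exists_ancestor_periodic h)
    set s := sInf {k | ∃ m, 0 < m ∧ f.ancestor v₁ (k + m) = f.ancestor v₁ k}
    obtain ⟨m, hm, hs⟩ := hmem
    obtain ⟨m, rfl⟩ : ∃ n, m = n + 1 := ⟨m - 1, by omega⟩
    -- The cycle is at distance at least `2`: `v₁` is grafted and `b` is not cyclic. The bound is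
    -- needed because `ancestor_eli` compares only positive new indices.
    have h0 : s ≠ 0 := by
      intro h0
      rw [h0, zero_add, ancestor_zero] at hs
      exact transGen_ne_of_mate (transGen_of_ancestor hs) hc.1 rfl
    have h1 : s ≠ 1 := by
      intro h1
      rw [h1, hone, add_comm, ancestor_succ_of_parent hb] at hs
      exact hcyc (transGen_of_ancestor hs)
    obtain ⟨t, ht⟩ : ∃ t, s = t + 2 := ⟨s - 2, by omega⟩
    rw [ht] at hs ⊢
    refine lt_of_le_of_lt (Nat.sInf_le (m := t + 1) ⟨m + 1, hm, ?_⟩) (by omega)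
    change (f.eli v₁ v₂ b hc.1 hb).ancestor v₁ (t + 1 + m + 1) = _
    rw [hanc, hanc, ← hs]
    congr 1
    omega

/-! ### The rank, and how each step changes it. -/

open Classical in
/-- The number of roots plus the number of vertices on cycles. -/
noncomputable def rank (f : LabForest) : ℕ :=
  (f.verts.filter fun v => f.parent v = none).card + (f.verts.filter f.Cyclic).card

section Rank

variable {f : LabForest} {v₁ v₂ b : ℕ}

open Classical in
lemma card_cyclic_eli_le (hc : f.Connecting v₁ v₂) (hb : f.parent v₁ = some b) :
    ((f.eli v₁ v₂ b hc.1 hb).verts.filter (f.eli v₁ v₂ b hc.1 hb).Cyclic).card ≤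
      (f.verts.filter f.Cyclic).card :=
  Finset.card_le_card fun u hu => by
    rw [Finset.mem_filter] at hu ⊢
    exact ⟨hu.1, hu.2.of_eli hc hb⟩

/-- The new roots inject into the old ones: `v₁` is a new root only if `b` was a root, and `b` only
if `v₂` was. The vertex `v₂` itself now has the parent `b`, so its value is free for `b`. -/
lemma card_roots_eli_le (hc : f.Connecting v₁ v₂) (hb : f.parent v₁ = some b) :
    ((f.eli v₁ v₂ b hc.1 hb).verts.filter fun v =>
      (f.eli v₁ v₂ b hc.1 hb).parent v = none).card ≤
      (f.verts.filter fun v => f.parent v = none).card := by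
  have hne := hc.ne_parent hb
  have hbm := (f.parent_mem _ _ hb).2
  have h2m := mem_of_mate hc.1
  refine Finset.card_le_card_of_injOn
    (fun u => if u = v₁ then b else if u = b then v₂ else u) ?_ ?_
  · intro u hu
    rw [Finset.mem_coe, Finset.mem_filter] at hu ⊢
    simp only [eli] at hu ⊢
    split_ifs at hu ⊢ with c1 c2
    · exact ⟨hbm, hu.2⟩
    · exact ⟨h2m, hu.2⟩
    · exact absurd hu.2 (by simp)
    · exact hu
  · intro u hu w hw huw
    rw [Finset.mem_coe, Finset.mem_filter] at hu hw
    simp only [eli] at hu hw huw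
    have c3 : u ≠ v₂ := by
      rintro rfl
      have : u ≠ v₁ := fun h => f.mate_ne _ (h ▸ hc.1 : f.mate u = some u)
      simp [this, hne.2.symm] at hu
    have c3' : w ≠ v₂ := by
      rintro rfl
      have : w ≠ v₁ := fun h => f.mate_ne _ (h ▸ hc.1 : f.mate w = some w)
      simp [this, hne.2.symm] at hw
    split_ifs at huw <;> simp_all

lemma rank_eli_le (hc : f.Connecting v₁ v₂) (hb : f.parent v₁ = some b) :
    (f.eli v₁ v₂ b hc.1 hb).rank ≤ f.rank :=
  add_le_add (card_roots_eli_le hc hb) (card_cyclic_eli_le hc hb)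

/-- The inversion takes `b` off its cycle and creates no cyclic vertex. -/
lemma rank_eli_lt (hc : f.Connecting v₁ v₂) (hb : f.parent v₁ = some b) (hcyc : f.Cyclic b) :
    (f.eli v₁ v₂ b hc.1 hb).rank < f.rank := by
  classical
  refine add_lt_add_of_le_of_lt (card_roots_eli_le hc hb) (Finset.card_lt_card ?_)
  refine Finset.ssubset_iff_of_subset (fun u hu => ?_) |>.2
    ⟨b, Finset.mem_filter.2 ⟨(f.parent_mem _ _ hb).2, hcyc⟩,
      fun h => not_cyclic_eli hc hb (Finset.mem_filter.1 h).2⟩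
  rw [Finset.mem_filter] at hu ⊢
  exact ⟨hu.1, hu.2.of_eli hc hb⟩

/-- A root is lost, and no cycle is gained because the new edge starts at a grafted vertex, which no
edge enters. -/
lemma rank_graft_lt {v : ℕ} (hm : f.mate v₁ = some v₂) (hr : f.parent v₁ = none)
    (h₁ : v₁ ∈ f.verts) (hv : v ∈ f.verts) (hv' : f.mate v = none) :
    (f.graft v₁ v h₁ hv hv').rank < f.rank := by
  classical
  refine add_lt_add_of_lt_of_le (Finset.card_lt_card ?_) (Finset.card_le_card fun u hu => ?_)
  · refine Finset.ssubset_iff_of_subset (fun u hu => ?_) |>.2 ⟨v₁, ?_, ?_⟩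
    · rw [Finset.mem_filter] at hu ⊢
      simp only [graft] at hu ⊢
      refine ⟨hu.1, ?_⟩
      have := hu.2
      split_ifs at this
      exact this
    · simp [h₁, hr]
    · rw [Finset.mem_filter]
      simp [graft]
  · rw [Finset.mem_filter] at hu ⊢
    refine ⟨hu.1, ?_⟩
    have key : ∀ x y, x ≠ v₁ → Relation.TransGen (f.graft v₁ v h₁ hv hv').Edge x y →
        Relation.TransGen f.Edge x y := by
      intro x y hx h
      induction h with
      | single h => exact .single (by simpa [Edge, graft, hx] using h)
      | tail hy h ih =>
        have := transGen_ne_of_mate hy (y := v₂) (x := v₁) hm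
        exact .tail ih (by simpa [Edge, graft, this] using h)
    exact key _ _ (transGen_ne_of_mate hu.2 (y := v₂) hm) hu.2

lemma rank_blacken_lt (hm : f.mate v₁ = some v₂) (hr : f.parent v₁ = none) :
    (f.blacken v₁ v₂ hm).rank < f.rank := by
  classical
  refine add_lt_add_of_lt_of_le (Finset.card_lt_card ?_) (Finset.card_le_card fun u hu => ?_)
  · refine Finset.ssubset_iff_of_subset (fun u hu => ?_) |>.2 ⟨v₁, ?_, ?_⟩
    · rw [Finset.mem_filter] at hu ⊢
      simp only [blacken, Finset.mem_erase] at hu ⊢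
      refine ⟨hu.1.2, ?_⟩
      simpa [hu.1.1] using hu.2
    · simp [f.mate_mem _ _ hm, hr]
    · simp [blacken]
  · rw [Finset.mem_filter] at hu ⊢
    refine ⟨Finset.mem_of_mem_erase hu.1, Relation.TransGen.mono (fun x y hxy => ?_) _ _ hu.2⟩
    simp only [Edge, blacken] at hxy
    split_ifs at hxy
    exact hxy

end Rank

end LabForest

/-! ### The minimal connecting liana and termination. -/

namespace VertexOrder

open LabForest

variable (O : VertexOrder)

lemma IsMinimal.mem {O : VertexOrder} {f : LabForest} {v w : ℕ} (h : O.IsMinimal f v w) :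
    v ∈ f.verts := f.mate_mem _ _ h.1.1

lemma IsMinimal.unique {O : VertexOrder} {f : LabForest} {v w v' w' : ℕ} (h : O.IsMinimal f v w)
    (h' : O.IsMinimal f v' w') : v = v' ∧ w = w' := by
  obtain rfl : v = v' := by
    rcases h.2 _ _ h'.1 with h1 | h1 <;> rcases h'.2 _ _ h.1 with h2 | h2
    · exact absurd h1 h2.asymm
    · exact absurd h2.1 h1.ne'
    · exact absurd h1.1 h2.ne'
    · exact O.le_antisymm f _ h.mem _ h'.mem h1.2 h2.2
  exact ⟨rfl, Option.some.inj (h.1.1.symm.trans h'.1.1)⟩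

lemma exists_isMinimal {f : LabForest} {v w : ℕ} (h : f.Connecting v w) :
    ∃ v₁ v₂, O.IsMinimal f v₁ v₂ := by
  classical
  let s := f.verts.filter fun v => ∃ w, f.Connecting v w
  have hs : ∀ v ∈ s, v ∈ f.verts := fun v hv => (Finset.mem_filter.1 hv).1
  -- The order axioms hold only on the vertices of `f`, so the minimum is built up over subsets of
  -- them.
  have key : ∀ t ⊆ s, t.Nonempty → ∃ x ∈ t, ∀ y ∈ t,
      f.depth x < f.depth y ∨ (f.depth x = f.depth y ∧ O.le f x y) := by
    intro t
    induction t using Finset.induction_on with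
    | empty => simp
    | insert a t _ ih =>
      intro hts _
      have ha := hs a (hts (Finset.mem_insert_self _ _))
      have hrefl : O.le f a a := (O.le_total f a ha a ha).elim id id
      rcases t.eq_empty_or_nonempty with rfl | ht
      · exact ⟨a, by simp, by simp [hrefl]⟩
      have hts' : t ⊆ s := (Finset.subset_insert _ _).trans hts
      obtain ⟨x, hx, hmin⟩ := ih hts' ht
      have hx' := hs x (hts' hx)
      have hcmp : (f.depth x < f.depth a ∨ (f.depth x = f.depth a ∧ O.le f x a)) ∨
          (f.depth a < f.depth x ∨ (f.depth a = f.depth x ∧ O.le f a x)) := by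
        rcases lt_trichotomy (f.depth x) (f.depth a) with h | h | h
        · exact Or.inl (Or.inl h)
        · rcases O.le_total f x hx' a ha with h' | h'
          · exact Or.inl (Or.inr ⟨h, h'⟩)
          · exact Or.inr (Or.inr ⟨h.symm, h'⟩)
        · exact Or.inr (Or.inl h)
      rcases hcmp with h | h
      · refine ⟨x, Finset.mem_insert_of_mem hx, fun y hy => ?_⟩
        rcases Finset.mem_insert.1 hy with rfl | hy
        · exact h
        · exact hmin y hy
      · refine ⟨a, Finset.mem_insert_self _ _, fun y hy => ?_⟩
        rcases Finset.mem_insert.1 hy with rfl | hy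
        · exact Or.inr ⟨rfl, hrefl⟩
        · rcases h with h | ⟨h, hl⟩ <;> rcases hmin y hy with h' | ⟨h', hl'⟩
          · exact Or.inl (h.trans h')
          · exact Or.inl (h'.symm ▸ h)
          · exact Or.inl (h.symm ▸ h')
          · exact Or.inr ⟨h.trans h', O.le_trans f a ha x hx' y (hs y (hts' hy)) hl hl'⟩
  obtain ⟨x, hx, hmin⟩ := key s subset_rfl ⟨v, Finset.mem_filter.2 ⟨f.mate_mem _ _ h.1, w, h⟩⟩
  obtain ⟨y, hy⟩ := (Finset.mem_filter.1 hx).2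
  exact ⟨x, y, hy, fun w₁ w₂ hw =>
    hmin w₁ (Finset.mem_filter.2 ⟨f.mate_mem _ _ hw.1, w₂, hw⟩)⟩

/-- The algorithm terminates, as an induction principle. -/
theorem algorithm_induction {P : LabForest → Prop}
    (done : ∀ f, (∀ v w, ¬ f.Connecting v w) → P f)
    (eli : ∀ f v₁ v₂ b (h : O.IsMinimal f v₁ v₂) (hb : f.parent v₁ = some b),
      P (f.eli v₁ v₂ b h.1.1 hb) → P f)
    (ibp : ∀ f v₁ v₂ (h : O.IsMinimal f v₁ v₂), f.parent v₁ = none →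
      (∀ v (hv : v ∈ f.verts) (hv' : f.mate v = none), P (f.graft v₁ v h.mem hv hv')) →
      P (f.blacken v₁ v₂ h.1.1) → P f) (f : LabForest) : P f := by
  -- Lexicographic induction on the rank and then on a bound for the depth of the minimal liana. A
  -- bound also covers forests without connecting liana.
  have main : ∀ n : ℕ, ∀ d : ℕ ×ₗ ℕ, ∀ f : LabForest, f.rank = n →
      (∀ v w, O.IsMinimal f v w → f.depth v ≤ d) → P f := by
    intro n
    induction n using Nat.strong_induction_on with
    | _ n ihn =>
    have ihn' : ∀ f : LabForest, f.rank < n → P f := by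
      intro f hf
      by_cases h : ∃ v w, O.IsMinimal f v w
      · obtain ⟨v, w, h⟩ := h
        exact ihn _ hf (f.depth v) f rfl fun v' w' h' => (h'.unique h).1 ▸ le_rfl
      · exact ihn _ hf (toLex (0, 0)) f rfl fun v w h' => absurd ⟨v, w, h'⟩ h
    intro d
    induction d using WellFoundedLT.induction with
    | _ d ihd =>
    intro f hn hd
    by_cases hcon : ∃ v w, f.Connecting v w
    · obtain ⟨v, w, hvw⟩ := hcon
      obtain ⟨v₁, v₂, h⟩ := O.exists_isMinimal hvw
      cases hp : f.parent v₁ with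
      | none =>
        exact ibp f v₁ v₂ h hp
          (fun v hv hv' => ihn' _ (hn ▸ rank_graft_lt h.1.1 hp h.mem hv hv'))
          (ihn' _ (hn ▸ rank_blacken_lt h.1.1 hp))
      | some b =>
        refine eli f v₁ v₂ b h hp ?_
        rcases lt_or_eq_of_le (rank_eli_le h.1 hp) with hlt | heq
        · exact ihn' _ (hn ▸ hlt)
        -- If the rank stays the same, `b` is off cycles. Then `{v₁, v₂}` is still connecting with
        -- smaller depth, and the new minimal liana cannot be deeper.
        have hcyc : ¬ f.Cyclic b := fun hc => (rank_eli_lt h.1 hp hc).ne heq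
        refine ihd _ (lt_of_lt_of_le (depth_eli_lt h.1 hp hcyc) (hd _ _ h)) _ (heq.trans hn) ?_
        intro v' w' h'
        rcases h'.2 _ _ (h.1.eli hp hcyc) with h'' | h''
        · exact h''.le
        · exact h''.1.le
    · push Not at hcon
      exact done f hcon
  by_cases h : ∃ v w, O.IsMinimal f v w
  · obtain ⟨v, w, h⟩ := h
    exact main _ (f.depth v) f rfl fun v' w' h' => (h'.unique h).1 ▸ le_rfl
  · exact main _ (toLex (0, 0)) f rfl fun v w h' => absurd ⟨v, w, h'⟩ h

end VertexOrder

/-! ### Invariants and finiteness of chains. -/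

namespace LabForest

open Classical in
/-- The black vertices. -/
noncomputable def blacks (f : LabForest) : Finset ℕ := f.verts.filter fun v => f.mate v = none

lemma mem_blacks {f : LabForest} {v : ℕ} : v ∈ f.blacks ↔ v ∈ f.verts ∧ f.mate v = none := by
  classical
  exact Finset.mem_filter

open Classical in
/-- The forest `graft f v₁ v`, with junk value `f` if it is not defined. -/
noncomputable def graftTo (f : LabForest) (v₁ v : ℕ) : LabForest :=
  if h : v₁ ∈ f.verts ∧ v ∈ f.verts ∧ f.mate v = none then f.graft v₁ v h.1 h.2.1 h.2.2 else f

lemma graftTo_eq {f : LabForest} {v₁ v : ℕ} (h₁ : v₁ ∈ f.verts) (hv : v ∈ f.verts)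
    (hv' : f.mate v = none) : f.graftTo v₁ v = f.graft v₁ v h₁ hv hv' :=
  dif_pos ⟨h₁, hv, hv'⟩

lemma card_blacks_le (f : LabForest) : f.blacks.card ≤ f.verts.card := by
  classical
  exact Finset.card_filter_le _ _

lemma Rooted.of_eli {f : LabForest} {v₁ v₂ b : ℕ} (hm : f.mate v₁ = some v₂)
    (hb : f.parent v₁ = some b) (h : (f.eli v₁ v₂ b hm hb).Rooted) : f.Rooted := by
  intro hn
  obtain ⟨u, hu, hu'⟩ := h hn
  simp only [eli] at hu'
  split_ifs at hu' with c1 c2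
  · exact ⟨b, (f.parent_mem _ _ hb).2, hu'⟩
  · exact ⟨v₂, mem_of_mate hm, hu'⟩
  · exact ⟨u, hu, hu'⟩

lemma Rooted.of_parent {f : LabForest} {v : ℕ} (hv : v ∈ f.verts) (h : f.parent v = none) :
    f.Rooted := fun _ => ⟨v, hv, h⟩

/-- One grafted vertex disappears and another turns black. -/
lemma card_add_card_blacks_blacken {f : LabForest} {v₁ v₂ : ℕ} (hm : f.mate v₁ = some v₂) :
    (f.blacken v₁ v₂ hm).verts.card + (f.blacken v₁ v₂ hm).blacks.card =
      f.verts.card + f.blacks.card := by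
  have h21 : v₂ ≠ v₁ := by
    rintro rfl
    exact f.mate_ne _ hm
  have h1 := f.mate_mem _ _ hm
  have h2 := mem_of_mate hm
  have hb : (f.blacken v₁ v₂ hm).blacks = insert v₂ f.blacks := by
    ext u
    rw [mem_blacks, Finset.mem_insert, mem_blacks]
    simp only [blacken, Finset.mem_erase]
    by_cases c1 : u = v₁
    · subst c1
      simp [hm, h21.symm]
    · by_cases c2 : u = v₂
      · subst c2
        simp [c1, h2]
      · simp [c1, c2]
  have hc : (f.blacken v₁ v₂ hm).verts.card + 1 = f.verts.card := Finset.card_erase_add_one h1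
  have hv₂ : v₂ ∉ f.blacks := by
    rw [mem_blacks, f.mate_symm _ _ hm]
    simp
  rw [hb, Finset.card_insert_of_notMem hv₂]
  omega

end LabForest

namespace LTC

open LabForest

variable {O : VertexOrder} {f : LabForest}

/-- IBP may leave a forest without roots, but no step creates a root where there was none. Hence a
chain with an exotic end passes only through exotic forests. -/
lemma rooted {f g : LabForest} (c : LTC O f g) (hg : g.Rooted) : f.Rooted := by
  induction c with
  | done => exact hg
  | eli v₁ v₂ b h hb c ih => exact (ih hg).of_eli
  | ibpVertex v₁ v₂ v h hr _ _ _ _ => exact Rooted.of_parent h.mem hr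
  | ibpBlack v₁ v₂ h hr _ _ => exact Rooted.of_parent h.mem hr

/-- This invariant bounds the size of the start of a chain by its end, and so makes the sums over
`π₀` finite. -/
lemma card_add_card_blacks {f g : LabForest} (c : LTC O f g) :
    f.verts.card + f.blacks.card = g.verts.card + g.blacks.card := by
  induction c with
  | done => rfl
  | eli v₁ v₂ b h hb c ih => exact ih
  | ibpVertex v₁ v₂ v h hr _ _ _ ih => exact ih
  | ibpBlack v₁ v₂ h hr _ ih => rw [← ih, card_add_card_blacks_blacken]

lemma card_le {f g : LabForest} (c : LTC O f g) : f.verts.card ≤ 2 * g.verts.card := by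
  have := c.card_add_card_blacks
  have := g.card_blacks_le
  omega

/-- The only chain that starts at a forest without connecting lianas. -/
lemma bijective_done (hf : ∀ v w, ¬ f.Connecting v w) :
    Function.Bijective (fun _ : Unit => (⟨f, .done f hf⟩ : Σ g, LTC O f g)) := by
  refine ⟨fun _ _ _ => rfl, ?_⟩
  rintro ⟨g, c⟩
  cases c with
  | done => exact ⟨(), rfl⟩
  | eli v₁ v₂ b h => exact absurd h.1 (hf _ _)
  | ibpVertex v₁ v₂ v h => exact absurd h.1 (hf _ _)
  | ibpBlack v₁ v₂ h => exact absurd h.1 (hf _ _)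

/-- Chains that start with an edge-liana inversion. -/
lemma bijective_eli {v₁ v₂ b : ℕ} (h : O.IsMinimal f v₁ v₂) (hb : f.parent v₁ = some b) :
    Function.Bijective (fun x : Σ g, LTC O (f.eli v₁ v₂ b h.1.1 hb) g =>
      (⟨x.1, .eli v₁ v₂ b h hb x.2⟩ : Σ g, LTC O f g)) := by
  constructor
  · rintro ⟨g, c⟩ ⟨g', c'⟩ e
    obtain rfl : g = g' := congrArg Sigma.fst e
    simpa using e
  · rintro ⟨g, c⟩
    cases c with
    | done _ hf => exact absurd h.1 (hf _ _)
    | eli w₁ w₂ b' h' hb' c =>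
      obtain ⟨rfl, rfl⟩ := h.unique h'
      obtain rfl : b = b' := Option.some.inj (hb.symm.trans hb')
      exact ⟨⟨g, c⟩, rfl⟩
    | ibpVertex w₁ w₂ v h' hr =>
      obtain ⟨rfl, rfl⟩ := h.unique h'
      simp [hb] at hr
    | ibpBlack w₁ w₂ h' hr =>
      obtain ⟨rfl, rfl⟩ := h.unique h'
      simp [hb] at hr

/-- Chains that start with an integration by parts. -/
lemma bijective_ibp {v₁ v₂ : ℕ} (h : O.IsMinimal f v₁ v₂) (hr : f.parent v₁ = none) :
    Function.Bijective (Sum.elim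
      (fun x : Σ v : {v // v ∈ f.verts ∧ f.mate v = none},
          Σ g, LTC O (f.graft v₁ v (f.mate_mem _ _ h.1.1) v.2.1 v.2.2) g =>
        (⟨x.2.1, .ibpVertex v₁ v₂ x.1 h hr x.1.2.1 x.1.2.2 x.2.2⟩ : Σ g, LTC O f g))
      (fun x : Σ g, LTC O (f.blacken v₁ v₂ h.1.1) g =>
        (⟨x.1, .ibpBlack v₁ v₂ h hr x.2⟩ : Σ g, LTC O f g))) := by
  constructor
  · rintro (⟨⟨v, hv⟩, g, c⟩ | ⟨g, c⟩) (⟨⟨v', hv'⟩, g', c'⟩ | ⟨g', c'⟩) e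
    · obtain rfl : g = g' := congrArg Sigma.fst e
      simp only [Sum.elim_inl, Sigma.mk.injEq, heq_eq_eq, true_and, ibpVertex.injEq] at e
      obtain ⟨rfl, e⟩ := e
      obtain rfl := eq_of_heq e
      rfl
    · obtain rfl : g = g' := congrArg Sigma.fst e
      simp at e
    · obtain rfl : g = g' := congrArg Sigma.fst e
      simp at e
    · obtain rfl : g = g' := congrArg Sigma.fst e
      simpa using e
  · rintro ⟨g, c⟩
    cases c with
    | done _ hf => exact absurd h.1 (hf _ _)
    | eli w₁ w₂ b' h' hb' c =>
      obtain ⟨rfl, rfl⟩ := h.unique h'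
      simp [hb'] at hr
    | ibpVertex w₁ w₂ v h' hr' hv hv' c =>
      obtain ⟨rfl, rfl⟩ := h.unique h'
      exact ⟨.inl ⟨⟨v, hv, hv'⟩, g, c⟩, rfl⟩
    | ibpBlack w₁ w₂ h' hr' c =>
      obtain ⟨rfl, rfl⟩ := h.unique h'
      exact ⟨.inr ⟨g, c⟩, rfl⟩

instance finite_black (f : LabForest) : Finite {v // v ∈ f.verts ∧ f.mate v = none} :=
  Set.Finite.subset f.verts.finite_toSet fun _ hv => hv.1

/-- Every labelled forest is the start of only finitely many chains. -/
instance finite_chains (O : VertexOrder) (f : LabForest) : Finite (Σ g, LTC O f g) := by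
  refine O.algorithm_induction (P := fun f => Finite (Σ g, LTC O f g)) ?_ ?_ ?_ f
  · exact fun f hf => Finite.of_surjective _ (bijective_done hf).2
  · exact fun f v₁ v₂ b h hb ih => Finite.of_surjective _ (bijective_eli h hb).2
  · intro f v₁ v₂ h hr ih ih'
    have := fun v : {v // v ∈ f.verts ∧ f.mate v = none} => ih v v.2.1 v.2.2
    exact Finite.of_surjective _ (bijective_ibp h hr).2

end LTC

/-! ### Weighted sums over chains and their recursion. -/

open LabForest

/-- The sum of `C(f → g) w(g)` over all chains `f → g` that start at `f`. -/
noncomputable def chainSum (O : VertexOrder) (w : LabForest → ℝ) (f : LabForest) : ℝ :=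
  ∑ᶠ x : Σ g, LTC O f g, w x.1 * x.2.coeff

section ChainSum

variable {O : VertexOrder} {w : LabForest → ℝ} {f : LabForest}

/-- Together with `chainSum_eli` and `chainSum_ibp` this is a recursion along the algorithm; the
coproduct formula and label independence are derived from it by `algorithm_induction`. -/
lemma chainSum_done (hf : ∀ v w, ¬ f.Connecting v w) : chainSum O w f = w f := by
  rw [chainSum, ← finsum_comp _ (LTC.bijective_done hf), finsum_eq_sum_of_fintype]
  simp [LTC.coeff]

lemma chainSum_eli {v₁ v₂ b : ℕ} (h : O.IsMinimal f v₁ v₂) (hb : f.parent v₁ = some b) :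
    chainSum O w f = chainSum O w (f.eli v₁ v₂ b h.1.1 hb) := by
  rw [chainSum, ← finsum_comp _ (LTC.bijective_eli h hb)]
  rfl

lemma chainSum_ibp {v₁ v₂ : ℕ} (h : O.IsMinimal f v₁ v₂) (hr : f.parent v₁ = none) :
    chainSum O w f = -∑ v ∈ f.blacks, chainSum O w (f.graftTo v₁ v) -
      2 * chainSum O w (f.blacken v₁ v₂ h.1.1) := by
  classical
  have := Fintype.ofFinite {v // v ∈ f.verts ∧ f.mate v = none}
  have := fun v : {v // v ∈ f.verts ∧ f.mate v = none} =>
    Fintype.ofFinite (Σ g, LTC O (f.graft v₁ v (f.mate_mem _ _ h.1.1) v.2.1 v.2.2) g)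
  have := Fintype.ofFinite (Σ g, LTC O (f.blacken v₁ v₂ h.1.1) g)
  rw [chainSum, ← finsum_comp _ (LTC.bijective_ibp h hr), finsum_eq_sum_of_fintype,
    Fintype.sum_sum_type, Fintype.sum_sigma, sub_eq_add_neg]
  congr 1
  · rw [← Finset.sum_neg_distrib, Finset.sum_subtype f.blacks
      (p := fun v => v ∈ f.verts ∧ f.mate v = none) (fun _ => mem_blacks)]
    refine Finset.sum_congr rfl fun v _ => ?_
    rw [graftTo_eq h.mem v.2.1 v.2.2, chainSum, finsum_eq_sum_of_fintype,
      ← Finset.sum_neg_distrib]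
    refine Finset.sum_congr rfl fun x _ => ?_
    simp only [Sum.elim_inl, LTC.coeff]
    ring
  · rw [chainSum, finsum_eq_sum_of_fintype, Finset.mul_sum, ← Finset.sum_neg_distrib]
    refine Finset.sum_congr rfl fun x _ => ?_
    simp only [Sum.elim_inr, LTC.coeff]
    ring

/-- A splitting may cut off a union of aromas, for which the axioms of `VertexOrder` say nothing.
Such factors are disposed of here. -/
lemma chainSum_eq_zero (hw : ∀ g : LabForest, ¬ g.Rooted → w g = 0) (hf : ¬ f.Rooted) :
    chainSum O w f = 0 := by
  rw [chainSum, finsum_eq_zero_of_forall_eq_zero]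
  intro x
  rw [hw _ fun hg => hf (x.2.rooted hg), zero_mul]

end ChainSum

/-! ### Concatenation, restriction and splittings of a forest. -/

namespace LabForest

section Concat

variable {f g : LabForest} (h : Disjoint f.verts g.verts)

lemma concat_parent_left {v : ℕ} (hv : v ∈ f.verts) : (f.concat g h).parent v = f.parent v :=
  if_pos hv

lemma concat_mate_left {v : ℕ} (hv : v ∈ f.verts) : (f.concat g h).mate v = f.mate v :=
  if_pos hv

lemma mem_left_iff_of_concat_parent {v w : ℕ} (he : (f.concat g h).parent v = some w) :
    v ∈ f.verts ↔ w ∈ f.verts := by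
  by_cases hv : v ∈ f.verts
  · rw [concat_parent_left h hv] at he
    exact iff_of_true hv (f.parent_mem _ _ he).2
  · have he' : g.parent v = some w := by simpa [concat, hv] using he
    exact iff_of_false hv (Finset.disjoint_right.1 h (g.parent_mem _ _ he').2)

lemma concat_sameComponent {v w : ℕ} (hv : v ∈ f.verts) :
    (f.concat g h).SameComponent v w ↔ f.SameComponent v w := by
  constructor
  · intro hs
    induction hs with
    | rel _ _ he => exact .rel _ _ (by rwa [concat_parent_left h hv] at he)
    | refl => exact .refl _
    | symm x y hxy ih =>
      have := SameComponent.mem_iff (S := {x | x ∈ f.verts})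
        (fun _ _ => mem_left_iff_of_concat_parent h) hxy
      exact .symm _ _ (ih (this.2 hv))
    | trans x y z hxy _ ih ih' =>
      have := SameComponent.mem_iff (S := {x | x ∈ f.verts})
        (fun _ _ => mem_left_iff_of_concat_parent h) hxy
      exact .trans _ _ _ (ih hv) (ih' (this.1 hv))
  · refine Relation.EqvGen.mono (fun x y hxy => ?_) _ _
    rwa [concat_parent_left h (f.parent_mem _ _ hxy).1]

lemma concat_connecting {v w : ℕ} (hv : v ∈ f.verts) :
    (f.concat g h).Connecting v w ↔ f.Connecting v w := by
  rw [Connecting, Connecting, concat_mate_left h hv, concat_sameComponent h hv]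

lemma concat_ancestor {v : ℕ} (hv : v ∈ f.verts) (k : ℕ) :
    (f.concat g h).ancestor v k = f.ancestor v k := by
  induction k with
  | zero => rfl
  | succ k ih =>
    rw [ancestor_succ, ancestor_succ, ih]
    cases hk : f.ancestor v k with
    | none => rfl
    | some y =>
      refine concat_parent_left h ?_
      cases k with
      | zero =>
        obtain rfl : v = y := Option.some.inj hk
        exact hv
      | succ k =>
        have := SameComponent.mem_iff (S := {x | x ∈ f.verts})
          (fun u w huw => iff_of_true (f.parent_mem _ _ huw).1 (f.parent_mem _ _ huw).2)
          (.of_transGen (transGen_of_ancestor hk))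
        exact this.1 hv

lemma concat_depth {v : ℕ} (hv : v ∈ f.verts) : (f.concat g h).depth v = f.depth v := by
  have : (f.concat g h).ancestor v = f.ancestor v := funext (concat_ancestor h hv)
  rw [depth, depth, this]

/-- Connecting lianas, depths and the vertex order of a factor do not change under concatenation,
and minimality in the whole is stronger than minimality in the factor. -/
lemma isMinimal_of_concat {O : VertexOrder} (hf : f.Rooted) (hg : g.Rooted) {v w : ℕ}
    (hv : v ∈ f.verts) (hm : O.IsMinimal (f.concat g h) v w) : O.IsMinimal f v w := by
  refine ⟨(concat_connecting h hv).1 hm.1, fun w₁ w₂ hw => ?_⟩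
  have hw₁ := f.mate_mem _ _ hw.1
  have := hm.2 w₁ w₂ ((concat_connecting h hw₁).2 hw)
  rwa [concat_depth h hv, concat_depth h hw₁, O.le_concat f g h hf hg v hv w₁ hw₁] at this

end Concat

/-- The subforest with vertices in `S`. -/
def restrict (f : LabForest) (S : Finset ℕ) : LabForest where
  verts := f.verts ∩ S
  parent v := if v ∈ S then (f.parent v).filter (· ∈ S) else none
  mate v := if v ∈ S then (f.mate v).filter (· ∈ S) else none
  parent_mem := by
    intro v w hw
    split_ifs at hw with hv
    obtain ⟨hw, hwS⟩ := Option.filter_eq_some_iff.1 hw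
    have := f.parent_mem _ _ hw
    simp_all
  parent_black := by
    intro v w hw
    split_ifs at hw with hv
    rw [f.parent_black v w (Option.filter_eq_some_iff.1 hw).1]
    simp
  mate_mem := by
    intro v w hw
    split_ifs at hw with hv
    exact Finset.mem_inter.2 ⟨f.mate_mem _ _ (Option.filter_eq_some_iff.1 hw).1, hv⟩
  mate_symm := by
    intro v w hw
    split_ifs at hw with hv
    obtain ⟨hw, hwS⟩ := Option.filter_eq_some_iff.1 hw
    have := f.mate_symm _ _ hw
    simp_all
  mate_ne := by
    intro v hw
    split_ifs at hw with hv
    exact f.mate_ne _ (Option.filter_eq_some_iff.1 hw).1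

/-- No edge and no liana leaves the set `S`. -/
def Splits (f : LabForest) (S : Finset ℕ) : Prop :=
  (∀ v w, f.parent v = some w → (v ∈ S ↔ w ∈ S)) ∧ ∀ v w, f.mate v = some w → (v ∈ S ↔ w ∈ S)

section Restrict

variable {f : LabForest} {S T : Finset ℕ}

/-- The filter in `restrict` only serves to define the subforest for every `S`; on a splitting set
it removes nothing. -/
lemma Splits.restrict_parent (h : f.Splits S) (v : ℕ) :
    (f.restrict S).parent v = if v ∈ S then f.parent v else none := by
  simp only [restrict]
  split_ifs with hv
  · cases hp : f.parent v with
    | none => rfl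
    | some w => simp [(h.1 _ _ hp).1 hv]
  · rfl

lemma Splits.restrict_mate (h : f.Splits S) (v : ℕ) :
    (f.restrict S).mate v = if v ∈ S then f.mate v else none := by
  simp only [restrict]
  split_ifs with hv
  · cases hp : f.mate v with
    | none => rfl
    | some w => simp [(h.2 _ _ hp).1 hv]
  · rfl

lemma Splits.compl (h : f.Splits S) : f.Splits (f.verts \ S) := by
  refine ⟨fun v w hw => ?_, fun v w hw => ?_⟩
  · simp [(f.parent_mem _ _ hw).1, (f.parent_mem _ _ hw).2, h.1 _ _ hw]
  · simp [f.mate_mem _ _ hw, mem_of_mate hw, h.2 _ _ hw]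

lemma restrict_disjoint (hd : Disjoint S T) :
    Disjoint (f.restrict S).verts (f.restrict T).verts :=
  hd.mono Finset.inter_subset_right Finset.inter_subset_right

lemma concat_restrict (hd : Disjoint S T) (hu : S ∪ T = f.verts) (hS : f.Splits S)
    (hT : f.Splits T) :
    (f.restrict S).concat (f.restrict T) (restrict_disjoint hd) = f := by
  have hSV : f.verts ∩ S = S := Finset.inter_eq_right.2 (hu ▸ Finset.subset_union_left)
  refine LabForest.ext ?_ (funext fun v => ?_) (funext fun v => ?_)
  · change f.verts ∩ S ∪ f.verts ∩ T = f.verts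
    rw [← Finset.inter_union_distrib_left, hu, Finset.inter_self]
  · change (if v ∈ f.verts ∩ S then _ else _) = _
    rw [hSV, hS.restrict_parent, hT.restrict_parent]
    split_ifs with h1 h2
    · rfl
    · rfl
    · cases hp : f.parent v with
      | none => rfl
      | some w =>
        have := (f.parent_mem _ _ hp).1
        rw [← hu, Finset.mem_union] at this
        tauto
  · change (if v ∈ f.verts ∩ S then _ else _) = _
    rw [hSV, hS.restrict_mate, hT.restrict_mate]
    split_ifs with h1 h2
    · rfl
    · rfl
    · cases hp : f.mate v with
      | none => rfl
      | some w =>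
        have := f.mate_mem _ _ hp
        rw [← hu, Finset.mem_union] at this
        tauto

lemma isMinimal_restrict {O : VertexOrder} (hd : Disjoint S T) (hu : S ∪ T = f.verts)
    (hS : f.Splits S) (hT : f.Splits T) (hrS : (f.restrict S).Rooted)
    (hrT : (f.restrict T).Rooted) {v w : ℕ} (hv : v ∈ S) (hm : O.IsMinimal f v w) :
    O.IsMinimal (f.restrict S) v w := by
  refine isMinimal_of_concat (restrict_disjoint hd) hrS hrT (Finset.mem_inter.2 ⟨hm.mem, hv⟩) ?_
  rwa [concat_restrict hd hu hS hT]

lemma not_connecting_restrict (hd : Disjoint S T) (hu : S ∪ T = f.verts) (hS : f.Splits S)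
    (hT : f.Splits T) (hf : ∀ v w, ¬ f.Connecting v w) (v w : ℕ) :
    ¬ (f.restrict S).Connecting v w := by
  intro hc
  refine hf v w ?_
  rw [← concat_restrict hd hu hS hT]
  exact (concat_connecting _ ((f.restrict S).mate_mem _ _ hc.1)).2 hc

lemma blacks_restrict (hS : f.Splits S) : (f.restrict S).blacks = f.blacks.filter (· ∈ S) := by
  ext v
  rw [mem_blacks, Finset.mem_filter, mem_blacks, hS.restrict_mate]
  by_cases hv : v ∈ S <;> simp [restrict, hv]

section Eli

variable {v₁ v₂ b : ℕ} (hc : f.Connecting v₁ v₂) (hb : f.parent v₁ = some b)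

/-- The liana and the edge at `b` (from `v₁` before, from `v₂` after) keep `v₁`, `v₂`, `b` on one
side. The inversion merely permutes places among these three, so the remaining conditions agree. -/
lemma splits_eli : (f.eli v₁ v₂ b hc.1 hb).Splits S ↔ f.Splits S := by
  have h21 : v₂ ≠ v₁ := by
    rintro rfl
    exact f.mate_ne _ hc.1
  have hne := hc.ne_parent hb
  constructor
  · rintro ⟨h1, h2⟩
    refine ⟨fun u w hw => ?_, h2⟩
    have e1 := h2 _ _ hc.1
    have e2 := h1 v₂ b (by simp [eli, h21, hne.2.symm])
    by_cases c1 : u = v₁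
    · subst c1
      obtain rfl : b = w := Option.some.inj (hb.symm.trans hw)
      rw [e1, e2]
    by_cases c2 : u = b
    · subst c2
      rw [← e2, ← e1]
      exact h1 _ _ (by simpa [eli] using hw)
    by_cases c3 : u = v₂
    · subst c3
      rw [e2]
      exact h1 _ _ (by simpa [eli, hne.1] using hw)
    exact h1 _ _ (by simpa [eli, c1, c2, c3] using hw)
  · rintro ⟨h1, h2⟩
    refine ⟨fun u w hw => ?_, h2⟩
    have e1 := h2 _ _ hc.1
    have e2 := h1 _ _ hb
    simp only [eli] at hw
    split_ifs at hw with c1 c2 c3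
    · rw [c1, e2, h1 _ _ hw]
    · rw [c2, ← e2, e1, h1 _ _ hw]
    · rw [c3, ← e1, e2, Option.some.inj hw]
    · exact h1 _ _ hw

lemma restrict_eli_of_notMem (hS : f.Splits S) (hv : v₁ ∉ S) :
    (f.eli v₁ v₂ b hc.1 hb).restrict S = f.restrict S := by
  have hv₂ : v₂ ∉ S := fun h => hv ((hS.2 _ _ hc.1).2 h)
  have hbS : b ∉ S := fun h => hv ((hS.1 _ _ hb).2 h)
  refine LabForest.ext rfl (funext fun u => ?_) rfl
  rw [hS.restrict_parent, ((splits_eli hc hb).2 hS).restrict_parent]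
  split_ifs with hu
  · refine eli_parent_of_ne hb hc.1 ?_ ?_ ?_ <;> rintro rfl <;> contradiction
  · rfl

lemma restrict_eli_of_mem (hS : f.Splits S) (hv : v₁ ∈ S)
    (hm' : (f.restrict S).mate v₁ = some v₂) (hb' : (f.restrict S).parent v₁ = some b) :
    (f.eli v₁ v₂ b hc.1 hb).restrict S = (f.restrict S).eli v₁ v₂ b hm' hb' := by
  have hv₂ : v₂ ∈ S := (hS.2 _ _ hc.1).1 hv
  have hbS : b ∈ S := (hS.1 _ _ hb).1 hv
  refine LabForest.ext rfl (funext fun u => ?_) rfl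
  rw [((splits_eli hc hb).2 hS).restrict_parent]
  simp only [eli, hS.restrict_parent]
  by_cases hu : u ∈ S
  · simp [hu, hbS, hv₂]
  · have h1 : u ≠ v₁ := by rintro rfl; contradiction
    have h2 : u ≠ v₂ := by rintro rfl; contradiction
    have h3 : u ≠ b := by rintro rfl; contradiction
    simp [hu, h1, h2, h3]

end Eli

section Ibp

variable {v₁ v₂ v : ℕ} (hm : f.mate v₁ = some v₂) (hr : f.parent v₁ = none)

lemma graftTo_verts : (f.graftTo v₁ v).verts = f.verts := by
  rw [graftTo]
  split_ifs <;> rfl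

lemma graftTo_mate : (f.graftTo v₁ v).mate = f.mate := by
  rw [graftTo]
  split_ifs <;> rfl

lemma graftTo_parent (h₁ : v₁ ∈ f.verts) (hv : v ∈ f.blacks) (u : ℕ) :
    (f.graftTo v₁ v).parent u = if u = v₁ then some v else f.parent u := by
  rw [graftTo_eq h₁ (mem_blacks.1 hv).1 (mem_blacks.1 hv).2]
  rfl

include hr in
lemma splits_graftTo (h₁ : v₁ ∈ f.verts) (hv : v ∈ f.blacks) :
    (f.graftTo v₁ v).Splits S ↔ f.Splits S ∧ (v₁ ∈ S ↔ v ∈ S) := by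
  simp only [Splits, graftTo_mate, graftTo_parent h₁ hv]
  constructor
  · rintro ⟨h1, h2⟩
    refine ⟨⟨fun u w hw => h1 u w ?_, h2⟩, h1 _ _ (by simp)⟩
    rw [if_neg, hw]
    rintro rfl
    simp [hr] at hw
  · rintro ⟨⟨h1, h2⟩, h3⟩
    refine ⟨fun u w hw => ?_, h2⟩
    split_ifs at hw with c
    · rw [c, h3, Option.some.inj hw]
    · exact h1 _ _ hw

include hr in
lemma restrict_graftTo_of_notMem (hS : f.Splits S) (h₁ : v₁ ∈ f.verts) (hv : v ∈ f.blacks)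
    (hv₁ : v₁ ∉ S) (hvS : v ∉ S) : (f.graftTo v₁ v).restrict S = f.restrict S := by
  have hS' := (splits_graftTo hr h₁ hv).2 ⟨hS, iff_of_false hv₁ hvS⟩
  refine LabForest.ext (by simp [restrict, graftTo_verts]) (funext fun u => ?_)
    (by simp [restrict, graftTo_mate])
  rw [hS.restrict_parent, hS'.restrict_parent, graftTo_parent h₁ hv]
  split_ifs with c1 c2
  · exact absurd (c2 ▸ c1) hv₁
  · rfl
  · rfl

include hr in
lemma restrict_graftTo_of_mem (hS : f.Splits S) (h₁ : v₁ ∈ f.verts) (hv : v ∈ f.blacks)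
    (hv₁ : v₁ ∈ S) (hvS : v ∈ S) :
    (f.graftTo v₁ v).restrict S = (f.restrict S).graftTo v₁ v := by
  have hS' := (splits_graftTo hr h₁ hv).2 ⟨hS, iff_of_true hv₁ hvS⟩
  refine LabForest.ext (by simp [restrict, graftTo_verts]) (funext fun u => ?_)
    (by simp [restrict, graftTo_mate])
  have hv' : v ∈ (f.restrict S).blacks := by
    rw [blacks_restrict hS]
    exact Finset.mem_filter.2 ⟨hv, hvS⟩
  rw [hS'.restrict_parent, graftTo_parent h₁ hv,
    graftTo_parent (Finset.mem_inter.2 ⟨h₁, hv₁⟩) hv', hS.restrict_parent]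
  by_cases c : u = v₁
  · simp [c, hv₁]
  · simp [c]

include hr in
lemma blacken_parent : (f.blacken v₁ v₂ hm).parent = f.parent := by
  funext u
  simp only [blacken]
  split_ifs with c
  · rw [c, hr]
  · rfl

include hr in
lemma splits_blacken_erase (hS : f.Splits S) : (f.blacken v₁ v₂ hm).Splits (S.erase v₁) := by
  refine ⟨fun u w hw => ?_, fun u w hw => ?_⟩
  · rw [blacken_parent hm hr] at hw
    have h1 : u ≠ v₁ := by
      rintro rfl
      simp [hr] at hw
    have h2 : w ≠ v₁ := transGen_ne_of_mate (.single hw) hm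
    simp [h1, h2, hS.1 _ _ hw]
  · simp only [blacken] at hw
    split_ifs at hw with c
    push Not at c
    have h2 : w ≠ v₁ := by
      rintro rfl
      exact c.2 (Option.some.inj ((f.mate_symm _ _ hw).symm.trans hm))
    simp [c.1, h2, hS.2 _ _ hw]

include hr in
lemma splits_of_blacken (hS : (f.blacken v₁ v₂ hm).Splits (S.erase v₁))
    (h12 : v₁ ∈ S ↔ v₂ ∈ S) : f.Splits S := by
  refine ⟨fun u w hw => ?_, fun u w hw => ?_⟩
  · have h1 : u ≠ v₁ := by
      rintro rfl
      simp [hr] at hw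
    have h2 : w ≠ v₁ := transGen_ne_of_mate (.single hw) hm
    simpa [h1, h2] using hS.1 u w (by rwa [blacken_parent hm hr])
  · by_cases c1 : u = v₁
    · rw [c1, h12, Option.some.inj ((c1 ▸ hm : f.mate u = some v₂).symm.trans hw)]
    by_cases c2 : u = v₂
    · rw [c2, ← h12, Option.some.inj ((f.mate_symm _ _ hm).symm.trans (c2 ▸ hw))]
    have h2 : w ≠ v₁ := by
      rintro rfl
      exact c2 (Option.some.inj ((f.mate_symm _ _ hw).symm.trans hm))
    simpa [c1, h2] using hS.2 u w (by simp [blacken, c1, c2, hw])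

include hr in
lemma restrict_blacken_of_notMem (hS : f.Splits S) (hv : v₁ ∉ S) :
    (f.blacken v₁ v₂ hm).restrict (S.erase v₁) = f.restrict S := by
  have hS' := splits_blacken_erase hm hr hS
  have hv₂ : v₂ ∉ S := fun h => hv ((hS.2 _ _ hm).2 h)
  refine LabForest.ext ?_ (funext fun u => ?_) (funext fun u => ?_)
  · ext u
    simp only [restrict, blacken, Finset.mem_inter, Finset.mem_erase]
    have : u ∈ S → u ≠ v₁ := by rintro h rfl; contradiction
    tauto
  · rw [hS'.restrict_parent, hS.restrict_parent, blacken_parent hm hr, Finset.erase_eq_of_notMem hv]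
  · rw [hS'.restrict_mate, hS.restrict_mate, Finset.erase_eq_of_notMem hv]
    split_ifs with hu
    · have h1 : u ≠ v₁ := by rintro rfl; contradiction
      have h2 : u ≠ v₂ := by rintro rfl; contradiction
      simp [blacken, h1, h2]
    · rfl

include hr in
lemma restrict_blacken_of_mem (hS : f.Splits S)
    (hm' : (f.restrict S).mate v₁ = some v₂) :
    (f.blacken v₁ v₂ hm).restrict (S.erase v₁) = (f.restrict S).blacken v₁ v₂ hm' := by
  have hS' := splits_blacken_erase hm hr hS
  have hr' : (f.restrict S).parent v₁ = none := by
    rw [hS.restrict_parent, hr, ite_self]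
  refine LabForest.ext ?_ (funext fun u => ?_) (funext fun u => ?_)
  · ext u
    simp only [restrict, blacken, Finset.mem_inter, Finset.mem_erase]
    tauto
  · rw [hS'.restrict_parent, blacken_parent hm' hr', hS.restrict_parent, blacken_parent hm hr]
    by_cases c : u = v₁
    · simp [c, hr]
    · simp [c]
  · rw [hS'.restrict_mate]
    simp only [blacken, hS.restrict_mate]
    by_cases c : u = v₁
    · simp [c]
    · simp [c]
      by_cases c2 : u = v₂ <;> simp [c2]

end Ibp

end Restrict

open Classical in
/-- The sets of vertices that split `f`. -/
noncomputable def splittings (f : LabForest) : Finset (Finset ℕ) :=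
  f.verts.powerset.filter f.Splits

lemma mem_splittings {f : LabForest} {S : Finset ℕ} :
    S ∈ f.splittings ↔ S ⊆ f.verts ∧ f.Splits S := by
  classical
  rw [splittings, Finset.mem_filter, Finset.mem_powerset]

lemma splittings_graftTo {f : LabForest} {v₁ v : ℕ} (hr : f.parent v₁ = none) (h₁ : v₁ ∈ f.verts)
    (hv : v ∈ f.blacks) :
    (f.graftTo v₁ v).splittings = f.splittings.filter (fun S => v₁ ∈ S ↔ v ∈ S) := by
  ext S
  rw [Finset.mem_filter, mem_splittings, mem_splittings, splits_graftTo hr h₁ hv, graftTo_verts,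
    and_assoc]

/-- The side on which the removed `v₁` was is recovered from the side of `v₂`. -/
lemma sum_splittings_blacken {f : LabForest} {v₁ v₂ : ℕ} (hm : f.mate v₁ = some v₂)
    (hr : f.parent v₁ = none) (F : Finset ℕ → ℝ) :
    ∑ S ∈ (f.blacken v₁ v₂ hm).splittings, F S = ∑ S ∈ f.splittings, F (S.erase v₁) := by
  have h1 := f.mate_mem _ _ hm
  have h2 := mem_of_mate hm
  have h21 : v₂ ≠ v₁ := by
    rintro rfl
    exact f.mate_ne _ hm
  symm
  refine Finset.sum_bij' (fun S _ => S.erase v₁)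
    (fun S _ => if v₂ ∈ S then insert v₁ S else S) ?_ ?_ ?_ ?_ (fun _ _ => rfl)
  · intro S hS
    rw [mem_splittings] at hS ⊢
    exact ⟨Finset.erase_subset_erase _ hS.1, splits_blacken_erase hm hr hS.2⟩
  · intro S hS
    rw [mem_splittings] at hS ⊢
    have hv : v₁ ∉ S := fun h => Finset.notMem_erase _ _ (hS.1 h)
    have hSf : S ⊆ f.verts := hS.1.trans (Finset.erase_subset _ _)
    split_ifs with c
    · refine ⟨Finset.insert_subset h1 hSf, splits_of_blacken hm hr ?_ (by simp [c])⟩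
      rw [Finset.erase_insert hv]
      exact hS.2
    · refine ⟨hSf, splits_of_blacken hm hr ?_ (iff_of_false hv c)⟩
      rw [Finset.erase_eq_of_notMem hv]
      exact hS.2
  · intro S hS
    have := (mem_splittings.1 hS).2.2 _ _ hm
    by_cases c : v₂ ∈ S
    · simp [c, h21, Finset.insert_erase (this.2 c)]
    · simp [c, Finset.erase_eq_of_notMem (mt this.1 c)]
  · intro S hS
    have hv : v₁ ∉ S := fun h => Finset.notMem_erase _ _ ((mem_splittings.1 hS).1 h)
    split_ifs with c
    · exact Finset.erase_insert hv
    · exact Finset.erase_eq_of_notMem hv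

end LabForest

/-! ### Compatibility of the algorithm with splittings. -/

open LabForest

section Coproduct

variable {O : VertexOrder} {u₁ u₂ : LabForest → ℝ} (h₁ : ∀ g : LabForest, ¬ g.Rooted → u₁ g = 0)
  (h₂ : ∀ g : LabForest, ¬ g.Rooted → u₂ g = 0) {f : LabForest} {S T : Finset ℕ}
  (hd : Disjoint S T) (hu : S ∪ T = f.verts) (hS : f.Splits S) (hT : f.Splits T) {v₁ v₂ : ℕ}
  (h : O.IsMinimal f v₁ v₂)

include h₁ h₂ hd hu hS hT

/-- The minimal liana lies in `S`, so the inversion is a step of the first factor and leaves the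
second alone. -/
lemma chainSum_mul_chainSum_eli {b : ℕ} (hb : f.parent v₁ = some b) (hv : v₁ ∈ S) :
    chainSum O u₁ ((f.eli v₁ v₂ b h.1.1 hb).restrict S) *
        chainSum O u₂ ((f.eli v₁ v₂ b h.1.1 hb).restrict T) =
      chainSum O u₁ (f.restrict S) * chainSum O u₂ (f.restrict T) := by
  have hm' : (f.restrict S).mate v₁ = some v₂ := by rw [hS.restrict_mate, if_pos hv, h.1.1]
  have hb' : (f.restrict S).parent v₁ = some b := by rw [hS.restrict_parent, if_pos hv, hb]
  rw [restrict_eli_of_notMem h.1 hb hT (Finset.disjoint_left.1 hd hv),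
    restrict_eli_of_mem h.1 hb hS hv hm' hb']
  by_cases hrS : (f.restrict S).Rooted
  · by_cases hrT : (f.restrict T).Rooted
    · rw [chainSum_eli (isMinimal_restrict hd hu hS hT hrS hrT hv h) hb']
    · rw [chainSum_eq_zero h₂ hrT, mul_zero, mul_zero]
  -- An unrooted factor remains unrooted under inversion, so both sides vanish.
  · rw [chainSum_eq_zero h₁ hrS, chainSum_eq_zero h₁ (mt (Rooted.of_eli hm' hb') hrS)]

omit h₁ in
-- Grafts within `S` together with the blackening form the full IBP recursion of the first factor.
-- That factor is rooted at `v₁`, so only the second may be unrooted.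
lemma chainSum_mul_chainSum_ibp (hr : f.parent v₁ = none) (hv : v₁ ∈ S) :
    -∑ v ∈ f.blacks with v ∈ S, chainSum O u₁ ((f.graftTo v₁ v).restrict S) *
        chainSum O u₂ ((f.graftTo v₁ v).restrict T) -
      2 * (chainSum O u₁ ((f.blacken v₁ v₂ h.1.1).restrict (S.erase v₁)) *
        chainSum O u₂ ((f.blacken v₁ v₂ h.1.1).restrict (T.erase v₁))) =
      chainSum O u₁ (f.restrict S) * chainSum O u₂ (f.restrict T) := by
  have hm' : (f.restrict S).mate v₁ = some v₂ := by rw [hS.restrict_mate, if_pos hv, h.1.1]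
  have hr' : (f.restrict S).parent v₁ = none := by rw [hS.restrict_parent, if_pos hv, hr]
  have hrS : (f.restrict S).Rooted := .of_parent (Finset.mem_inter.2 ⟨h.mem, hv⟩) hr'
  have hvT := Finset.disjoint_left.1 hd hv
  have hsum : ∑ v ∈ f.blacks with v ∈ S, chainSum O u₁ ((f.graftTo v₁ v).restrict S) *
      chainSum O u₂ ((f.graftTo v₁ v).restrict T) =
      (∑ v ∈ (f.restrict S).blacks, chainSum O u₁ ((f.restrict S).graftTo v₁ v)) *
        chainSum O u₂ (f.restrict T) := by
    rw [blacks_restrict hS, Finset.sum_mul]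
    refine Finset.sum_congr rfl fun v hvb => ?_
    rw [Finset.mem_filter] at hvb
    rw [restrict_graftTo_of_notMem hr hT h.mem hvb.1 hvT (Finset.disjoint_left.1 hd hvb.2),
      restrict_graftTo_of_mem hr hS h.mem hvb.1 hv hvb.2]
  rw [hsum, restrict_blacken_of_notMem h.1.1 hr hT hvT,
    restrict_blacken_of_mem h.1.1 hr hS hm']
  by_cases hrT : (f.restrict T).Rooted
  · rw [chainSum_ibp (isMinimal_restrict hd hu hS hT hrS hrT hv h) hr']
    ring
  · rw [chainSum_eq_zero h₂ hrT]
    ring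

end Coproduct

/-- The algorithm is compatible with the decompositions of a forest into two factors. -/
theorem chainSum_eq_sum_splittings (O : VertexOrder) {u u₁ u₂ : LabForest → ℝ}
    (h₁ : ∀ g : LabForest, ¬ g.Rooted → u₁ g = 0) (h₂ : ∀ g : LabForest, ¬ g.Rooted → u₂ g = 0)
    (hu : ∀ f : LabForest,
      u f = ∑ S ∈ f.splittings, u₁ (f.restrict S) * u₂ (f.restrict (f.verts \ S)))
    (f : LabForest) :
    chainSum O u f = ∑ S ∈ f.splittings,
      chainSum O u₁ (f.restrict S) * chainSum O u₂ (f.restrict (f.verts \ S)) := by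
  have hd : ∀ (f : LabForest) (S : Finset ℕ), Disjoint S (f.verts \ S) :=
    fun _ _ => Finset.disjoint_sdiff
  refine O.algorithm_induction (P := fun f => chainSum O u f = ∑ S ∈ f.splittings,
      chainSum O u₁ (f.restrict S) * chainSum O u₂ (f.restrict (f.verts \ S))) ?_ ?_ ?_ f
  · intro f hf
    rw [chainSum_done hf, hu]
    refine Finset.sum_congr rfl fun S hS => ?_
    obtain ⟨hSV, hS⟩ := mem_splittings.1 hS
    have hun := Finset.union_sdiff_of_subset hSV
    rw [chainSum_done (not_connecting_restrict (hd f S) hun hS hS.compl hf),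
      chainSum_done (not_connecting_restrict (hd f S).symm (by rwa [Finset.union_comm])
        hS.compl hS hf)]
  · intro f v₁ v₂ b h hb ih
    rw [chainSum_eli h hb, ih]
    refine Finset.sum_congr ?_ fun S hS => ?_
    · ext S
      rw [mem_splittings, mem_splittings, splits_eli h.1 hb]
      rfl
    rw [mem_splittings] at hS
    have hSV : S ⊆ f.verts := hS.1
    have hun := Finset.union_sdiff_of_subset hSV
    by_cases hv : v₁ ∈ S
    · exact chainSum_mul_chainSum_eli h₁ h₂ (hd f S) hun hS.2 hS.2.compl h hb hv
    -- The two factors play symmetric roles; here the liana lies in the complement.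
    · rw [mul_comm, mul_comm (chainSum O u₁ (f.restrict S))]
      exact chainSum_mul_chainSum_eli h₂ h₁ (hd f S).symm (by rwa [Finset.union_comm])
        hS.2.compl hS.2 h hb (Finset.mem_sdiff.2 ⟨h.mem, hv⟩)
  · intro f v₁ v₂ h hr ih ih'
    have ihg : ∀ v ∈ f.blacks, chainSum O u (f.graftTo v₁ v) =
        ∑ S ∈ f.splittings, if v₁ ∈ S ↔ v ∈ S then
          chainSum O u₁ ((f.graftTo v₁ v).restrict S) *
            chainSum O u₂ ((f.graftTo v₁ v).restrict (f.verts \ S)) else 0 := by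
      intro v hv
      have hv' := mem_blacks.1 hv
      have := ih v hv'.1 hv'.2
      rw [← graftTo_eq h.mem hv'.1 hv'.2, splittings_graftTo hr h.mem hv, graftTo_verts] at this
      rw [this, Finset.sum_filter]
    -- Exchange of sums: for a fixed splitting, only the grafts onto black vertices on the side of
    -- `v₁` survive.
    rw [chainSum_ibp h hr, Finset.sum_congr rfl ihg, Finset.sum_comm, ih',
      sum_splittings_blacken h.1.1 hr, Finset.mul_sum, ← Finset.sum_neg_distrib,
      ← Finset.sum_sub_distrib]
    refine Finset.sum_congr rfl fun S hS => ?_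
    obtain ⟨hSV, hS⟩ := mem_splittings.1 hS
    have hun := Finset.union_sdiff_of_subset hSV
    have hV : (f.blacken v₁ v₂ h.1.1).verts \ S.erase v₁ = (f.verts \ S).erase v₁ := by
      ext x
      simp only [blacken, Finset.mem_sdiff, Finset.mem_erase]
      tauto
    rw [← Finset.sum_filter, hV]
    by_cases hv : v₁ ∈ S
    · rw [← chainSum_mul_chainSum_ibp h₂ (hd f S) hun hS hS.compl h hr hv]
      simp only [hv, true_iff]
    · rw [mul_comm (chainSum O u₁ (f.restrict S)),
        ← chainSum_mul_chainSum_ibp h₁ (hd f S).symm (by rwa [Finset.union_comm]) hS.compl hS h hr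
          (Finset.mem_sdiff.2 ⟨h.mem, hv⟩)]
      congr 2
      · refine Finset.sum_congr (Finset.filter_congr fun v hvb => ?_) fun v _ => mul_comm _ _
        simp [hv, (mem_blacks.1 hvb).1]
      · rw [mul_comm (chainSum O u₁ _)]

/-! ### Isomorphisms, their number, and independence of the labels. -/

namespace LabForest

/-- The map `φ` restricts to an isomorphism from `f` to `g`. -/
structure IsoOn (f g : LabForest) (φ : ℕ → ℕ) : Prop where
  bijOn : Set.BijOn φ f.verts g.verts
  parent : ∀ v ∈ f.verts, g.parent (φ v) = (f.parent v).map φ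
  mate : ∀ v ∈ f.verts, g.mate (φ v) = (f.mate v).map φ

namespace IsoOn

variable {f g k : LabForest} {φ ψ : ℕ → ℕ}

lemma mem (h : IsoOn f g φ) {v : ℕ} (hv : v ∈ f.verts) : φ v ∈ g.verts := h.bijOn.mapsTo hv

lemma eq_iff (h : IsoOn f g φ) {v w : ℕ} (hv : v ∈ f.verts) (hw : w ∈ f.verts) :
    φ v = φ w ↔ v = w := h.bijOn.injOn.eq_iff hv hw

lemma congr (h : IsoOn f g φ) (e : Set.EqOn φ ψ f.verts) : IsoOn f g ψ where
  bijOn := h.bijOn.congr e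
  parent v hv := by
    rw [← e hv, h.parent v hv]
    cases hp : f.parent v with
    | none => rfl
    | some w => exact congrArg some (e (f.parent_mem _ _ hp).2)
  mate v hv := by
    rw [← e hv, h.mate v hv]
    cases hp : f.mate v with
    | none => rfl
    | some w => exact congrArg some (e (mem_of_mate hp))

lemma symm (h : IsoOn f g φ) :
    ∃ ψ, IsoOn g f ψ ∧ (∀ v ∈ f.verts, ψ (φ v) = v) ∧ ∀ v ∈ g.verts, φ (ψ v) = v := by
  have hinv := h.bijOn.invOn_invFunOn
  have hb := h.bijOn.symm hinv.symm
  set ψ := Function.invFunOn φ f.verts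
  refine ⟨ψ, ⟨hb, fun v hv => ?_, fun v hv => ?_⟩, fun v hv => hinv.1 hv, fun v hv => hinv.2 hv⟩
  · have := h.parent (ψ v) (hb.mapsTo hv)
    rw [hinv.2 hv] at this
    rw [this]
    cases hp : f.parent (ψ v) with
    | none => rfl
    | some w => exact congrArg some (hinv.1 (f.parent_mem _ _ hp).2).symm
  · have := h.mate (ψ v) (hb.mapsTo hv)
    rw [hinv.2 hv] at this
    rw [this]
    cases hp : f.mate (ψ v) with
    | none => rfl
    | some w => exact congrArg some (hinv.1 (mem_of_mate hp)).symm

lemma card_eq (h : IsoOn f g φ) : f.verts.card = g.verts.card := by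
  have := h.bijOn.ncard_eq
  simpa using this

lemma rooted (h : IsoOn f g φ) (hg : g.Rooted) : f.Rooted := by
  rintro ⟨v, hv⟩
  obtain ⟨w, hw, hw'⟩ := hg ⟨_, h.mem hv⟩
  obtain ⟨u, hu, rfl⟩ := h.bijOn.surjOn hw
  rw [h.parent u hu] at hw'
  exact ⟨u, hu, Option.map_eq_none_iff.1 hw'⟩

lemma rooted_iff (h : IsoOn f g φ) : f.Rooted ↔ g.Rooted := by
  obtain ⟨ψ, hψ, -⟩ := h.symm
  exact ⟨hψ.rooted, h.rooted⟩

lemma map_mate (h : IsoOn f g φ) {v w : ℕ} (hv : f.mate v = some w) :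
    g.mate (φ v) = some (φ w) := by
  rw [h.mate v (f.mate_mem _ _ hv), hv]
  rfl

lemma map_parent (h : IsoOn f g φ) {v w : ℕ} (hv : f.parent v = some w) :
    g.parent (φ v) = some (φ w) := by
  rw [h.parent v (f.parent_mem _ _ hv).1, hv]
  rfl

lemma map_sameComponent (h : IsoOn f g φ) {v w : ℕ} (hs : f.SameComponent v w) :
    g.SameComponent (φ v) (φ w) := by
  induction hs with
  | rel _ _ he => exact .rel _ _ (h.map_parent he)
  | refl => exact .refl _
  | symm _ _ _ ih => exact .symm _ _ ih
  | trans _ _ _ _ _ ih ih' => exact .trans _ _ _ ih ih'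

lemma map_connecting (h : IsoOn f g φ) {v w : ℕ} (hc : f.Connecting v w) :
    g.Connecting (φ v) (φ w) := by
  obtain ⟨ψ, hψ, hinv, -⟩ := h.symm
  refine ⟨h.map_mate hc.1, fun hs => hc.2 ?_⟩
  have := hψ.map_sameComponent hs
  rwa [hinv v (f.mate_mem _ _ hc.1), hinv w (mem_of_mate hc.1)] at this

lemma ancestor (h : IsoOn f g φ) {v : ℕ} (hv : v ∈ f.verts) (k : ℕ) :
    g.ancestor (φ v) k = (f.ancestor v k).map φ ∧ ∀ y, f.ancestor v k = some y → y ∈ f.verts := by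
  induction k with
  | zero => exact ⟨rfl, fun y hy => Option.some.inj hy ▸ hv⟩
  | succ k ih =>
    rw [ancestor_succ, ancestor_succ, ih.1]
    cases hk : f.ancestor v k with
    | none => simp
    | some y => exact ⟨h.parent y (ih.2 y hk), fun z hz => (f.parent_mem _ _ hz).2⟩

lemma depth (h : IsoOn f g φ) {v : ℕ} (hv : v ∈ f.verts) : g.depth (φ v) = f.depth v := by
  have e1 : ∀ k, g.ancestor (φ v) k = none ↔ f.ancestor v k = none := fun k => by
    rw [(h.ancestor hv k).1, Option.map_eq_none_iff]
  have e2 : ∀ i j, g.ancestor (φ v) i = g.ancestor (φ v) j ↔ f.ancestor v i = f.ancestor v j := by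
    intro i j
    have hi := h.ancestor hv i
    have hj := h.ancestor hv j
    rw [hi.1, hj.1]
    cases hx : f.ancestor v i <;> cases hy : f.ancestor v j <;> simp
    exact h.eq_iff (hi.2 _ hx) (hj.2 _ hy)
  unfold LabForest.depth
  by_cases hk : ∃ k, f.ancestor v k = none
  · rw [if_pos hk, if_pos (by simpa only [e1] using hk)]
    simp only [e1]
  · rw [if_neg hk, if_neg (by simpa only [e1] using hk)]
    simp only [e2]

lemma isMinimal (h : IsoOn f g φ) {O : VertexOrder}
    (hO : ∀ v ∈ f.verts, ∀ w ∈ f.verts, O.le f v w ↔ O.le g (φ v) (φ w)) {v w : ℕ}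
    (hm : O.IsMinimal f v w) : O.IsMinimal g (φ v) (φ w) := by
  refine ⟨h.map_connecting hm.1, fun x y hxy => ?_⟩
  obtain ⟨ψ, hψ, -, hinv⟩ := h.symm
  have hx := g.mate_mem _ _ hxy.1
  have := hm.2 _ _ (hψ.map_connecting hxy)
  rwa [hψ.depth hx, hO _ hm.mem _ (hψ.mem hx), hinv x hx, ← h.depth hm.mem] at this

/-- The same `φ` serves before and after a step, also when a vertex is removed; this is the
advantage of maps on `ℕ` over equivalences of vertex sets. -/
lemma eli (h : IsoOn f g φ) {v₁ v₂ b : ℕ} (hm : f.mate v₁ = some v₂) (hb : f.parent v₁ = some b)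
    (hm' : g.mate (φ v₁) = some (φ v₂)) (hb' : g.parent (φ v₁) = some (φ b)) :
    IsoOn (f.eli v₁ v₂ b hm hb) (g.eli (φ v₁) (φ v₂) (φ b) hm' hb') φ where
  bijOn := h.bijOn
  parent u hu := by
    have h1 := f.mate_mem _ _ hm
    have h2 := mem_of_mate hm
    have h3 := (f.parent_mem _ _ hb).2
    simp only [LabForest.eli, h.eq_iff hu h1, h.eq_iff hu h2, h.eq_iff hu h3, h.parent _ h3,
      h.parent _ h2, h.parent _ hu]
    split_ifs <;> rfl
  mate := h.mate

lemma blacks (h : IsoOn f g φ) : g.blacks = f.blacks.image φ := by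
  ext y
  rw [Finset.mem_image]
  constructor
  · intro hy
    rw [mem_blacks] at hy
    obtain ⟨v, hv, rfl⟩ := h.bijOn.surjOn hy.1
    exact ⟨v, mem_blacks.2 ⟨hv, by simpa [h.mate v hv] using hy.2⟩, rfl⟩
  · rintro ⟨v, hv, rfl⟩
    rw [mem_blacks] at hv ⊢
    exact ⟨h.mem hv.1, by simp [h.mate v hv.1, hv.2]⟩

lemma graft (h : IsoOn f g φ) {v₁ v : ℕ} (h₁ : v₁ ∈ f.verts) (hv : v ∈ f.blacks) :
    IsoOn (f.graftTo v₁ v) (g.graftTo (φ v₁) (φ v)) φ where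
  bijOn := by simpa [graftTo_verts] using h.bijOn
  parent u hu := by
    rw [graftTo_verts] at hu
    have hv' : φ v ∈ g.blacks := h.blacks ▸ Finset.mem_image_of_mem _ hv
    simp only [graftTo_parent h₁ hv, graftTo_parent (h.mem h₁) hv', h.eq_iff hu h₁, h.parent _ hu]
    split_ifs <;> rfl
  mate := by simpa [graftTo_verts, graftTo_mate] using h.mate

lemma blacken (h : IsoOn f g φ) {v₁ v₂ : ℕ} (hm : f.mate v₁ = some v₂)
    (hm' : g.mate (φ v₁) = some (φ v₂)) :
    IsoOn (f.blacken v₁ v₂ hm) (g.blacken (φ v₁) (φ v₂) hm') φ := by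
  have h1 := f.mate_mem _ _ hm
  have h2 := mem_of_mate hm
  refine ⟨?_, fun u hu => ?_, fun u hu => ?_⟩
  · simp only [LabForest.blacken, Finset.coe_erase]
    exact h.bijOn.sdiff_singleton h1
  · have hu' := Finset.mem_of_mem_erase hu
    simp only [LabForest.blacken, h.eq_iff hu' h1, h.parent _ hu']
    split_ifs <;> rfl
  · have hu' := Finset.mem_of_mem_erase hu
    simp only [LabForest.blacken, h.eq_iff hu' h1, h.eq_iff hu' h2, h.mate _ hu']
    split_ifs <;> rfl

end IsoOn

/-- A bijection of finite sets, extended by `0`. -/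
noncomputable def extendZero {s t : Finset ℕ} (e : s ≃ t) (v : ℕ) : ℕ :=
  open Classical in if h : v ∈ s then e ⟨v, h⟩ else 0

lemma extendZero_apply {s t : Finset ℕ} (e : s ≃ t) (v : s) : extendZero e v = e v := dif_pos v.2

lemma bijOn_extendZero {s t : Finset ℕ} (e : s ≃ t) : Set.BijOn (extendZero e) s t := by
  refine ⟨fun v hv => ?_, fun v hv w hw hvw => ?_, fun w hw => ?_⟩
  · rw [extendZero_apply e ⟨v, hv⟩]
    exact (e ⟨v, hv⟩).2
  · rw [extendZero_apply e ⟨v, hv⟩, extendZero_apply e ⟨w, hw⟩] at hvw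
    exact Subtype.ext_iff.1 (e.injective (Subtype.ext hvw))
  · exact ⟨e.symm ⟨w, hw⟩, (e.symm ⟨w, hw⟩).2, by rw [extendZero_apply]; simp⟩

lemma IsIso.isoOn {f g : LabForest} {e : f.verts ≃ g.verts} (h : IsIso f g e) :
    IsoOn f g (extendZero e) := by
  have hb := bijOn_extendZero e
  refine ⟨hb, fun v hv => ?_, fun v hv => ?_⟩
  · ext y
    rw [extendZero_apply e ⟨v, hv⟩, Option.map_eq_some_iff]
    constructor
    · intro hy
      obtain ⟨w, hw, rfl⟩ := hb.surjOn (g.parent_mem _ _ hy).2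
      rw [extendZero_apply e ⟨w, hw⟩] at hy
      exact ⟨w, (h ⟨v, hv⟩ ⟨w, hw⟩).1.2 hy, rfl⟩
    · rintro ⟨w, hw, rfl⟩
      rw [extendZero_apply e ⟨w, (f.parent_mem _ _ hw).2⟩]
      exact (h ⟨v, hv⟩ ⟨w, (f.parent_mem _ _ hw).2⟩).1.1 hw
  · ext y
    rw [extendZero_apply e ⟨v, hv⟩, Option.map_eq_some_iff]
    constructor
    · intro hy
      obtain ⟨w, hw, rfl⟩ := hb.surjOn (mem_of_mate hy)
      rw [extendZero_apply e ⟨w, hw⟩] at hy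
      exact ⟨w, (h ⟨v, hv⟩ ⟨w, hw⟩).2.2 hy, rfl⟩
    · rintro ⟨w, hw, rfl⟩
      rw [extendZero_apply e ⟨w, mem_of_mate hw⟩]
      exact (h ⟨v, hv⟩ ⟨w, mem_of_mate hw⟩).2.1 hw

lemma IsoOn.isIso {f g : LabForest} {φ : ℕ → ℕ} (h : IsoOn f g φ) :
    IsIso f g (h.bijOn.equiv φ) := by
  intro v w
  change (_ ↔ g.parent (φ v) = some (φ w)) ∧ (_ ↔ g.mate (φ v) = some (φ w))
  rw [h.parent v v.2, h.mate v v.2, Option.map_eq_some_iff, Option.map_eq_some_iff]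
  refine ⟨⟨fun e => ⟨w, e, rfl⟩, ?_⟩, ⟨fun e => ⟨w, e, rfl⟩, ?_⟩⟩
  · rintro ⟨x, hx, hxw⟩
    rwa [← (h.eq_iff (f.parent_mem _ _ hx).2 w.2).1 hxw]
  · rintro ⟨x, hx, hxw⟩
    rwa [← (h.eq_iff (mem_of_mate hx) w.2).1 hxw]

/-- The number of isomorphisms from `f` to `g`. -/
noncomputable def isoCard (f g : LabForest) : ℕ := Nat.card {e : f.verts ≃ g.verts // IsIso f g e}

/-- The isomorphisms from `f` to `g`, extended by `0`. -/
def isoSet (f g : LabForest) : Set (ℕ → ℕ) := {φ | IsoOn f g φ ∧ ∀ v ∉ f.verts, φ v = 0}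

lemma mem_isoSet {f g : LabForest} {φ : ℕ → ℕ} :
    φ ∈ isoSet f g ↔ IsoOn f g φ ∧ ∀ v ∉ f.verts, φ v = 0 := Iff.rfl

lemma extendZero_injective {s t : Finset ℕ} :
    Function.Injective (extendZero : s ≃ t → ℕ → ℕ) := by
  intro e e' h
  ext v
  rw [← extendZero_apply, ← extendZero_apply, h]

lemma isoSet_eq_image (f g : LabForest) : isoSet f g = extendZero '' {e | IsIso f g e} := by
  ext φ
  rw [mem_isoSet]
  constructor
  · rintro ⟨h, h0⟩
    refine ⟨_, h.isIso, funext fun v => ?_⟩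
    by_cases hv : v ∈ f.verts
    · exact extendZero_apply _ ⟨v, hv⟩
    · rw [h0 v hv, extendZero, dif_neg hv]
  · rintro ⟨e, he, rfl⟩
    exact ⟨he.isoOn, fun v hv => dif_neg hv⟩

lemma isoSet_finite (f g : LabForest) : (isoSet f g).Finite := by
  rw [isoSet_eq_image]
  exact (Set.toFinite _).image _

lemma ncard_isoSet (f g : LabForest) : (isoSet f g).ncard = isoCard f g := by
  rw [isoSet_eq_image, Set.ncard_image_of_injective _ extendZero_injective]
  rfl

lemma isoCard_congr {f f' g g' : LabForest} {φ : f.verts ≃ f'.verts} {ψ : g.verts ≃ g'.verts}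
    (hφ : IsIso f f' φ) (hψ : IsIso g g' ψ) : isoCard f g = isoCard f' g' :=
  Nat.card_congr
    { toFun := fun α => ⟨(φ.symm.trans α.1).trans ψ, (hφ.symm.trans α.2).trans hψ⟩
      invFun := fun β => ⟨(φ.trans β.1).trans ψ.symm, (hφ.trans β.2).trans hψ.symm⟩
      left_inv := fun α => Subtype.ext (by ext x; simp)
      right_inv := fun β => Subtype.ext (by ext x; simp) }

lemma isoCard_eq_zero {f g : LabForest} (h : ¬ ∃ φ, IsIso f g φ) : isoCard f g = 0 := by
  have : IsEmpty {e : f.verts ≃ g.verts // IsIso f g e} := ⟨fun e => h ⟨e.1, e.2⟩⟩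
  exact Nat.card_of_isEmpty

lemma isoCard_self_pos (f : LabForest) : 0 < isoCard f f := by
  have : Nonempty {e : f.verts ≃ f.verts // IsIso f f e} := ⟨⟨_, IsIso.refl f⟩⟩
  exact Nat.card_pos

lemma isoCard_eq_zero_of_not_rooted {f g : LabForest} (hf : f.Rooted) (hg : ¬ g.Rooted) :
    isoCard f g = 0 :=
  isoCard_eq_zero fun ⟨_, h⟩ => hg (h.isoOn.rooted_iff.1 hf)

section Concat

variable {p q f : LabForest} (hd : Disjoint p.verts q.verts) {φ : ℕ → ℕ} {S : Finset ℕ}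

lemma concat_parent_right {v : ℕ} (hv : v ∈ q.verts) : (p.concat q hd).parent v = q.parent v :=
  if_neg (Finset.disjoint_right.1 hd hv)

lemma concat_mate_right {v : ℕ} (hv : v ∈ q.verts) : (p.concat q hd).mate v = q.mate v :=
  if_neg (Finset.disjoint_right.1 hd hv)

lemma IsoOn.image_mem_splittings (h : IsoOn (p.concat q hd) f φ) :
    p.verts.image φ ∈ f.splittings := by
  have key : ∀ v w, v ∈ (p.concat q hd).verts → w ∈ (p.concat q hd).verts →
      (v ∈ p.verts ↔ w ∈ p.verts) → (φ v ∈ p.verts.image φ ↔ φ w ∈ p.verts.image φ) := by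
    have : ∀ v ∈ (p.concat q hd).verts, φ v ∈ p.verts.image φ ↔ v ∈ p.verts := by
      intro v hv
      refine ⟨fun hm => ?_, Finset.mem_image_of_mem φ⟩
      obtain ⟨u, hu, huv⟩ := Finset.mem_image.1 hm
      rwa [← (h.eq_iff (Finset.mem_union_left _ hu) hv).1 huv]
    intro v w hv hw hvw
    rw [this v hv, this w hw, hvw]
  rw [mem_splittings]
  refine ⟨Finset.image_subset_iff.2 fun v hv => h.mem (Finset.mem_union_left _ hv),
    fun x y hxy => ?_, fun x y hxy => ?_⟩
  · obtain ⟨v, hv, rfl⟩ := h.bijOn.surjOn (f.parent_mem _ _ hxy).1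
    rw [h.parent v hv] at hxy
    obtain ⟨w, hw, rfl⟩ := Option.map_eq_some_iff.1 hxy
    exact key v w hv ((p.concat q hd).parent_mem _ _ hw).2 (mem_left_iff_of_concat_parent hd hw)
  · obtain ⟨v, hv, rfl⟩ := h.bijOn.surjOn (f.mate_mem _ _ hxy)
    rw [h.mate v hv] at hxy
    obtain ⟨w, hw, rfl⟩ := Option.map_eq_some_iff.1 hxy
    refine key v w hv (mem_of_mate hw) ?_
    by_cases hvp : v ∈ p.verts
    · rw [concat_mate_left hd hvp] at hw
      exact iff_of_true hvp (mem_of_mate hw)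
    · have hvq := (Finset.mem_union.1 hv).resolve_left hvp
      rw [concat_mate_right hd hvq] at hw
      exact iff_of_false hvp (Finset.disjoint_right.1 hd (mem_of_mate hw))

lemma isoOn_concat_iff (hSV : S ⊆ f.verts) (hS : f.Splits S) :
    IsoOn (p.concat q hd) f φ ∧ p.verts.image φ = S ↔
      IsoOn p (f.restrict S) φ ∧ IsoOn q (f.restrict (f.verts \ S)) φ := by
  have e1 : (f.restrict S).verts = S := Finset.inter_eq_right.2 hSV
  have e2 : (f.restrict (f.verts \ S)).verts = f.verts \ S :=
    Finset.inter_eq_right.2 Finset.sdiff_subset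
  constructor
  · rintro ⟨h, hi⟩
    have hp : ∀ v ∈ p.verts, φ v ∈ S := fun v hv => hi ▸ Finset.mem_image_of_mem φ hv
    have hq : ∀ v ∈ q.verts, φ v ∈ f.verts \ S := by
      refine fun v hv => Finset.mem_sdiff.2 ⟨h.mem (Finset.mem_union_right _ hv), fun hm => ?_⟩
      rw [← hi] at hm
      obtain ⟨u, hu, huv⟩ := Finset.mem_image.1 hm
      rw [h.eq_iff (Finset.mem_union_left _ hu) (Finset.mem_union_right _ hv)] at huv
      exact Finset.disjoint_left.1 hd hu (huv ▸ hv)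
    refine ⟨⟨?_, fun v hv => ?_, fun v hv => ?_⟩, ⟨?_, fun v hv => ?_, fun v hv => ?_⟩⟩
    · rw [e1]
      refine ⟨hp, h.bijOn.injOn.mono fun v hv => Finset.mem_union_left _ hv, fun y hy => ?_⟩
      rw [← hi] at hy
      simpa using hy
    · rw [hS.restrict_parent, if_pos (hp v hv), h.parent v (Finset.mem_union_left _ hv),
        concat_parent_left hd hv]
    · rw [hS.restrict_mate, if_pos (hp v hv), h.mate v (Finset.mem_union_left _ hv),
        concat_mate_left hd hv]
    · rw [e2]
      refine ⟨hq, h.bijOn.injOn.mono fun v hv => Finset.mem_union_right _ hv, fun y hy => ?_⟩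
      have hy' := Finset.mem_sdiff.1 hy
      obtain ⟨v, hv, rfl⟩ := h.bijOn.surjOn hy'.1
      exact ⟨v, (Finset.mem_union.1 hv).resolve_left fun hvp => hy'.2 (hp v hvp), rfl⟩
    · rw [hS.compl.restrict_parent, if_pos (hq v hv), h.parent v (Finset.mem_union_right _ hv),
        concat_parent_right hd hv]
    · rw [hS.compl.restrict_mate, if_pos (hq v hv), h.mate v (Finset.mem_union_right _ hv),
        concat_mate_right hd hv]
  · rintro ⟨h1, h2⟩
    have hp : ∀ v ∈ p.verts, φ v ∈ S := fun v hv => e1 ▸ h1.mem hv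
    have hq : ∀ v ∈ q.verts, φ v ∈ f.verts \ S := fun v hv => e2 ▸ h2.mem hv
    have hpq : ∀ v ∈ p.verts, ∀ w ∈ q.verts, φ v ≠ φ w := fun v hv w hw e =>
      (Finset.mem_sdiff.1 (hq w hw)).2 (e ▸ hp v hv)
    refine ⟨⟨⟨fun v hv => ?_, fun v hv w hw hvw => ?_, fun y hy => ?_⟩, fun v hv => ?_,
      fun v hv => ?_⟩, ?_⟩
    · rcases Finset.mem_union.1 hv with hv | hv
      · exact hSV (hp v hv)
      · exact Finset.sdiff_subset (hq v hv)
    · rcases Finset.mem_union.1 hv with hv | hv <;> rcases Finset.mem_union.1 hw with hw | hw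
      · exact (h1.eq_iff hv hw).1 hvw
      · exact absurd hvw (hpq v hv w hw)
      · exact absurd hvw.symm (hpq w hw v hv)
      · exact (h2.eq_iff hv hw).1 hvw
    · by_cases hyS : y ∈ S
      · obtain ⟨v, hv, rfl⟩ := h1.bijOn.surjOn (e1.symm ▸ hyS : y ∈ (f.restrict S).verts)
        exact ⟨v, Finset.mem_union_left _ hv, rfl⟩
      · obtain ⟨v, hv, rfl⟩ := h2.bijOn.surjOn
          (e2.symm ▸ Finset.mem_sdiff.2 ⟨hy, hyS⟩ : y ∈ (f.restrict (f.verts \ S)).verts)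
        exact ⟨v, Finset.mem_union_right _ hv, rfl⟩
    · rcases Finset.mem_union.1 hv with hv | hv
      · have := h1.parent v hv
        rwa [hS.restrict_parent, if_pos (hp v hv), ← concat_parent_left hd hv] at this
      · have := h2.parent v hv
        rwa [hS.compl.restrict_parent, if_pos (hq v hv), ← concat_parent_right hd hv] at this
    · rcases Finset.mem_union.1 hv with hv | hv
      · have := h1.mate v hv
        rwa [hS.restrict_mate, if_pos (hp v hv), ← concat_mate_left hd hv] at this
      · have := h2.mate v hv
        rwa [hS.compl.restrict_mate, if_pos (hq v hv), ← concat_mate_right hd hv] at this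
    · ext y
      rw [Finset.mem_image]
      refine ⟨fun ⟨v, hv, e⟩ => e ▸ hp v hv, fun hy => ?_⟩
      obtain ⟨v, hv, e⟩ := h1.bijOn.surjOn (e1.symm ▸ hy : y ∈ (f.restrict S).verts)
      exact ⟨v, hv, e⟩

lemma ncard_isoSet_concat_fiber (hSV : S ⊆ f.verts) (hS : f.Splits S) :
    {φ ∈ isoSet (p.concat q hd) f | p.verts.image φ = S}.ncard =
      isoCard p (f.restrict S) * isoCard q (f.restrict (f.verts \ S)) := by
  classical
  have hqp : ∀ v ∈ q.verts, v ∉ p.verts := fun v hv => Finset.disjoint_right.1 hd hv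
  rw [← ncard_isoSet, ← ncard_isoSet, ← Set.ncard_prod]
  refine Set.ncard_congr
    (fun φ _ => (fun v => if v ∈ p.verts then φ v else 0, fun v => if v ∈ q.verts then φ v else 0))
    ?_ ?_ ?_
  · rintro φ ⟨⟨h, h0⟩, hi⟩
    obtain ⟨h1, h2⟩ := (isoOn_concat_iff hd hSV hS).1 ⟨h, hi⟩
    exact ⟨⟨h1.congr fun v hv => (if_pos hv).symm, fun v hv => if_neg hv⟩,
      ⟨h2.congr fun v hv => (if_pos hv).symm, fun v hv => if_neg hv⟩⟩
  · rintro φ ψ ⟨⟨_, h0⟩, _⟩ ⟨⟨_, h0'⟩, _⟩ e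
    funext v
    have e1 := congrFun (congrArg Prod.fst e) v
    have e2 := congrFun (congrArg Prod.snd e) v
    by_cases hp : v ∈ p.verts
    · simpa [hp] using e1
    by_cases hq : v ∈ q.verts
    · simpa [hq] using e2
    have hv : v ∉ (p.concat q hd).verts := fun h => (Finset.mem_union.1 h).elim hp hq
    rw [h0 v hv, h0' v hv]
  · rintro ⟨φ, ψ⟩ ⟨⟨h1, h1'⟩, ⟨h2, h2'⟩⟩
    dsimp only at h1 h1' h2 h2'
    have hk := (isoOn_concat_iff (φ := fun v => if v ∈ p.verts then φ v else ψ v) hd hSV hS).2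
      ⟨h1.congr fun v hv => (if_pos hv).symm, h2.congr fun v hv => (if_neg (hqp v hv)).symm⟩
    refine ⟨_, ⟨⟨hk.1, fun v hv => ?_⟩, hk.2⟩, ?_⟩
    · have hv := Finset.mem_union.not.1 hv
      push Not at hv
      rw [if_neg hv.1, h2' v hv.2]
    · refine Prod.ext (funext fun v => ?_) (funext fun v => ?_)
      · dsimp only
        split_ifs with hv
        · rfl
        · exact (h1' v hv).symm
      · dsimp only
        split_ifs with hv hv'
        · exact absurd hv' (hqp v hv)
        · rfl
        · exact (h2' v hv).symm

/-- Isomorphisms are sorted by the image of `p`, which splits `f`. This is the coproduct formula at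
the end of a chain. -/
lemma isoCard_concat : isoCard (p.concat q hd) f =
    ∑ S ∈ f.splittings, isoCard p (f.restrict S) * isoCard q (f.restrict (f.verts \ S)) := by
  classical
  have hfin := isoSet_finite (p.concat q hd) f
  rw [← ncard_isoSet, Set.ncard_eq_toFinset_card _ hfin,
    Finset.card_eq_sum_card_fiberwise (f := fun φ => p.verts.image φ) (t := f.splittings)]
  · refine Finset.sum_congr rfl fun S hS => ?_
    obtain ⟨hSV, hS⟩ := mem_splittings.1 hS
    rw [← ncard_isoSet_concat_fiber hd hSV hS, ← Set.ncard_coe_finset]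
    congr 1
    ext φ
    simp
  · intro φ hφ
    rw [Finset.mem_coe, Set.Finite.mem_toFinset] at hφ
    exact hφ.1.image_mem_splittings

end Concat

end LabForest

open LabForest

lemma VertexOrder.exists_isoOn (O : VertexOrder) {f g : LabForest} (hf : f.Rooted) (hg : g.Rooted)
    (h : ∃ φ, IsIso f g φ) : ∃ φ, IsoOn f g φ ∧
      ∀ v ∈ f.verts, ∀ w ∈ f.verts, O.le f v w ↔ O.le g (φ v) (φ w) := by
  obtain ⟨e, he, hO⟩ := O.le_iso f g hf hg h
  refine ⟨_, he.isoOn, fun v hv w hw => ?_⟩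
  rw [extendZero_apply e ⟨v, hv⟩, extendZero_apply e ⟨w, hw⟩]
  exact hO ⟨v, hv⟩ ⟨w, hw⟩

/-- The outcome of the algorithm does not depend on the labels. -/
theorem chainSum_congr (O : VertexOrder) {u : LabForest → ℝ}
    (h₀ : ∀ g : LabForest, ¬ g.Rooted → u g = 0)
    (hu : ∀ f g : LabForest, (∃ φ, IsIso f g φ) → u f = u g) {f g : LabForest}
    (h : ∃ φ, IsIso f g φ) : chainSum O u f = chainSum O u g := by
  -- `le_iso` provides some order-preserving isomorphism, but not every isomorphism is one, and a
  -- step may spoil it. It is therefore chosen anew at every stage, and the induction runs over all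
  -- `g` isomorphic to `f`.
  have red : ∀ {f : LabForest},
      (f.Rooted → ∀ (g : LabForest) (φ : ℕ → ℕ), IsoOn f g φ →
        (∀ v ∈ f.verts, ∀ w ∈ f.verts, O.le f v w ↔ O.le g (φ v) (φ w)) →
        chainSum O u f = chainSum O u g) →
      ∀ g : LabForest, (∃ φ, IsIso f g φ) → chainSum O u f = chainSum O u g := by
    intro f hf g hg
    have hr : f.Rooted ↔ g.Rooted := hg.elim fun φ h => h.isoOn.rooted_iff
    by_cases hrf : f.Rooted
    · obtain ⟨φ, hφ, hO⟩ := O.exists_isoOn hrf (hr.1 hrf) hg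
      exact hf hrf g φ hφ hO
    · rw [chainSum_eq_zero h₀ hrf, chainSum_eq_zero h₀ (mt hr.2 hrf)]
  refine O.algorithm_induction (P := fun f => ∀ g : LabForest, (∃ φ, IsIso f g φ) →
    chainSum O u f = chainSum O u g) ?_ ?_ ?_ f g h
  · intro f hf
    refine red fun hrf g φ h hO => ?_
    obtain ⟨ψ, hψ, -⟩ := h.symm
    rw [chainSum_done hf, chainSum_done fun v w hc => hf _ _ (hψ.map_connecting hc)]
    exact hu f g ⟨_, h.isIso⟩
  · intro f v₁ v₂ b hm hb ih
    refine red fun hrf g φ h hO => ?_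
    have hm' := h.isMinimal hO hm
    have hb' := h.map_parent hb
    rw [chainSum_eli hm hb, chainSum_eli hm' hb']
    exact ih _ ⟨_, (h.eli hm.1.1 hb hm'.1.1 hb').isIso⟩
  · intro f v₁ v₂ hm hr ih ih'
    refine red fun hrf g φ h hO => ?_
    have hm' := h.isMinimal hO hm
    have hr' : g.parent (φ v₁) = none := by rw [h.parent v₁ hm.mem, hr]; rfl
    rw [chainSum_ibp hm hr, chainSum_ibp hm' hr', ih' _ ⟨_, (h.blacken hm.1.1 hm'.1.1).isIso⟩,
      h.blacks, Finset.sum_image fun v hv w hw e =>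
        (h.eq_iff (mem_blacks.1 hv).1 (mem_blacks.1 hw).1).1 e]
    congr 2
    refine Finset.sum_congr rfl fun v hv => ?_
    have hv' := mem_blacks.1 hv
    have := ih v hv'.1 hv'.2 (g.graftTo (φ v₁) (φ v))
    rw [← graftTo_eq hm.mem hv'.1 hv'.2] at this
    exact this ⟨_, (h.graft hm.mem hv).isIso⟩

/-! ### Enumeration of labelled forests and exponential generating series. -/

namespace LabForest

lemma finite_setOf_verts_eq (W : Finset ℕ) : {f : LabForest | f.verts = W}.Finite := by
  classical
  refine Set.Finite.of_injOn (t := ((W ×ˢ W).powerset ×ˢ (W ×ˢ W).powerset : Finset _))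
    (f := fun f => ((W ×ˢ W).filter fun x => f.parent x.1 = some x.2,
      (W ×ˢ W).filter fun x => f.mate x.1 = some x.2)) ?_ ?_ (Finset.finite_toSet _)
  · intro f _
    rw [Finset.mem_coe, Finset.mem_product, Finset.mem_powerset, Finset.mem_powerset]
    exact ⟨Finset.filter_subset _ _, Finset.filter_subset _ _⟩
  · rintro f rfl g hg e
    have e1 := congrArg Prod.fst e
    have e2 := congrArg Prod.snd e
    refine LabForest.ext hg.symm (funext fun v => Option.ext fun w => ?_)
      (funext fun v => Option.ext fun w => ?_)
    · have := Finset.ext_iff.1 e1 (v, w)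
      simp only [Finset.mem_filter, Finset.mem_product] at this
      have h1 := f.parent_mem v w
      have h2 := g.parent_mem v w
      rw [hg] at h2
      tauto
    · have := Finset.ext_iff.1 e2 (v, w)
      simp only [Finset.mem_filter, Finset.mem_product] at this
      have h1 := f.mate_mem v w
      have h2 := g.mate_mem v w
      have h3 := mem_of_mate (f := f) (v := v) (w := w)
      have h4 := mem_of_mate (f := g) (v := v) (w := w)
      rw [hg] at h2 h4
      tauto

/-- The labelled forests with vertex set `W`. -/
noncomputable def withVerts (W : Finset ℕ) : Finset LabForest :=
  (finite_setOf_verts_eq W).toFinset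

lemma mem_withVerts {W : Finset ℕ} {f : LabForest} : f ∈ withVerts W ↔ f.verts = W :=
  Set.Finite.mem_toFinset _

/-- The complements of finite sets are countably infinite, hence in bijection. The extension makes
`relabel` applicable. -/
lemma exists_perm_extending {s t : Finset ℕ} (e : s ≃ t) :
    ∃ σ : Equiv.Perm ℕ, ∀ v : s, σ v = e v := by
  have : Infinite {x // x ∉ s} := s.finite_toSet.infinite_compl.to_subtype
  have : Infinite {x // x ∉ t} := t.finite_toSet.infinite_compl.to_subtype
  obtain ⟨e'⟩ := nonempty_equiv_of_countable (α := {x // x ∉ s}) (β := {x // x ∉ t})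
  refine ⟨Equiv.subtypeCongr e e', fun v => ?_⟩
  simp [Equiv.subtypeCongr]

lemma exists_perm_image_eq {s t : Finset ℕ} (h : s.card = t.card) :
    ∃ σ : Equiv.Perm ℕ, s.image σ = t := by
  obtain ⟨σ, hσ⟩ := exists_perm_extending (Finset.equivOfCardEq h)
  refine ⟨σ, Finset.eq_of_subset_of_card_le (Finset.image_subset_iff.2 fun v hv => ?_) ?_⟩
  · rw [hσ ⟨v, hv⟩]
    exact (Finset.equivOfCardEq h ⟨v, hv⟩).2
  · rw [Finset.card_image_of_injective _ σ.injective, h]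

lemma isoOn_relabel (f : LabForest) (σ : Equiv.Perm ℕ) :
    IsoOn f (f.relabel σ σ.symm σ.symm_apply_apply) σ where
  bijOn := by
    simp only [relabel, Finset.coe_image]
    exact σ.injective.injOn.bijOn_image
  parent v _ := by simp [relabel]
  mate v _ := by simp [relabel]

lemma relabel_symm_relabel (f : LabForest) (σ : Equiv.Perm ℕ) :
    (f.relabel σ σ.symm σ.symm_apply_apply).relabel σ.symm σ σ.apply_symm_apply = f := by
  refine LabForest.ext ?_ (funext fun v => ?_) (funext fun v => ?_)
  · simp [relabel, Finset.image_image]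
  · simp [relabel, Option.map_map]
  · simp [relabel, Option.map_map]

/-- A function of forests that does not depend on the labels. -/
def Invariant (F : LabForest → ℝ) : Prop :=
  ∀ f g : LabForest, (∃ φ, IsIso f g φ) → F f = F g

lemma Invariant.sum_withVerts {F : LabForest → ℝ} (hF : Invariant F) {W W' : Finset ℕ}
    (h : W.card = W'.card) : ∑ f ∈ withVerts W, F f = ∑ f ∈ withVerts W', F f := by
  obtain ⟨σ, rfl⟩ := exists_perm_image_eq h
  refine Finset.sum_bij' (fun f _ => f.relabel σ σ.symm σ.symm_apply_apply)
    (fun f _ => f.relabel σ.symm σ σ.apply_symm_apply) ?_ ?_ ?_ ?_ ?_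
  · intro f hf
    rw [mem_withVerts] at hf ⊢
    rw [← hf]
    rfl
  · intro f hf
    rw [mem_withVerts] at hf ⊢
    simp [relabel, hf, Finset.image_image]
  · exact fun f _ => relabel_symm_relabel f σ
  · exact fun f _ => relabel_symm_relabel f σ.symm
  · exact fun f _ => hF _ _ ⟨_, (isoOn_relabel f σ).isIso⟩

lemma IsoOn.eq {p f g : LabForest} {φ : ℕ → ℕ} (h : IsoOn p f φ) (h' : IsoOn p g φ)
    (e : f.verts = g.verts) : f = g := by
  refine LabForest.ext e (funext fun y => ?_) (funext fun y => ?_)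
  · by_cases hy : y ∈ f.verts
    · obtain ⟨v, hv, rfl⟩ := h.bijOn.surjOn hy
      rw [h.parent v hv, h'.parent v hv]
    · rw [Option.eq_none_iff_forall_not_mem.2 fun w hw => hy (f.parent_mem y w hw).1,
        Option.eq_none_iff_forall_not_mem.2 fun w hw => hy (e ▸ (g.parent_mem y w hw).1)]
  · by_cases hy : y ∈ f.verts
    · obtain ⟨v, hv, rfl⟩ := h.bijOn.surjOn hy
      rw [h.mate v hv, h'.mate v hv]
    · rw [Option.eq_none_iff_forall_not_mem.2 fun w hw => hy (f.mate_mem y w hw),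
        Option.eq_none_iff_forall_not_mem.2 fun w hw => hy (e ▸ g.mate_mem y w hw)]

/-- Every bijection from the vertices of `p` to `W` is an isomorphism to exactly one forest. -/
lemma sum_isoCard (p : LabForest) {W : Finset ℕ} (h : p.verts.card = W.card) :
    ∑ f ∈ withVerts W, isoCard p f = W.card.factorial := by
  classical
  -- Every bijection transports the structure of `p` to a forest on `W`; by `IsoOn.eq` that forest
  -- is unique, so the union is disjoint.
  have key : ((withVerts W).biUnion fun f => (isoSet_finite p f).toFinset) =
      Finset.univ.image (extendZero : p.verts ≃ W → ℕ → ℕ) := by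
    ext φ
    simp only [Finset.mem_biUnion, mem_withVerts, Set.Finite.mem_toFinset, Finset.mem_image,
      Finset.mem_univ, true_and]
    constructor
    · rintro ⟨f, rfl, hφ⟩
      rw [isoSet_eq_image] at hφ
      obtain ⟨e, -, rfl⟩ := hφ
      exact ⟨e, rfl⟩
    · rintro ⟨e, rfl⟩
      obtain ⟨σ, hσ⟩ := exists_perm_extending e
      have hi : IsoOn p (p.relabel σ σ.symm σ.symm_apply_apply) (extendZero e) :=
        (isoOn_relabel p σ).congr fun v hv => by rw [extendZero_apply e ⟨v, hv⟩, hσ ⟨v, hv⟩]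
      refine ⟨_, ?_, hi, fun v hv => dif_neg hv⟩
      exact Finset.coe_injective
        (hi.bijOn.image_eq.symm.trans (bijOn_extendZero e).image_eq)
  have hcard := congrArg Finset.card key
  rw [Finset.card_image_of_injective _ extendZero_injective, Finset.card_univ,
    Fintype.card_equiv (Finset.equivOfCardEq h), Fintype.card_coe, h, Finset.card_biUnion] at hcard
  · rw [← hcard]
    refine Finset.sum_congr rfl fun f _ => ?_
    rw [← ncard_isoSet, Set.ncard_eq_toFinset_card _ (isoSet_finite p f)]
  · intro f hf g hg hne
    refine Finset.disjoint_left.2 fun φ hφ hφ' => ?_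
    rw [Set.Finite.mem_toFinset] at hφ hφ'
    exact hne (hφ.1.eq hφ'.1 ((mem_withVerts.1 hf).trans (mem_withVerts.1 hg).symm))

lemma splits_concat {f g : LabForest} (h : Disjoint f.verts g.verts) :
    (f.concat g h).Splits f.verts := by
  refine ⟨fun v w => mem_left_iff_of_concat_parent h, fun v w hw => ?_⟩
  by_cases hv : v ∈ f.verts
  · rw [concat_mate_left h hv] at hw
    exact iff_of_true hv (mem_of_mate hw)
  · have hw' : g.mate v = some w := by simpa [concat, hv] using hw
    exact iff_of_false hv (Finset.disjoint_right.1 h (mem_of_mate hw'))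

lemma restrict_concat_left {f g : LabForest} (h : Disjoint f.verts g.verts) :
    (f.concat g h).restrict f.verts = f := by
  refine LabForest.ext (Finset.inter_eq_right.2 Finset.subset_union_left) (funext fun v => ?_)
    (funext fun v => ?_)
  · rw [(splits_concat h).restrict_parent]
    split_ifs with hv
    · exact concat_parent_left h hv
    · exact (Option.eq_none_iff_forall_not_mem.2 fun w hw => hv (f.parent_mem v w hw).1).symm
  · rw [(splits_concat h).restrict_mate]
    split_ifs with hv
    · exact concat_mate_left h hv
    · exact (Option.eq_none_iff_forall_not_mem.2 fun w hw => hv (f.mate_mem v w hw)).symm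

lemma concat_comm {f g : LabForest} (h : Disjoint f.verts g.verts) :
    f.concat g h = g.concat f h.symm := by
  have hn : ∀ (f : LabForest) v, v ∉ f.verts → f.parent v = none ∧ f.mate v = none := fun f v hv =>
    ⟨Option.eq_none_iff_forall_not_mem.2 fun w hw => hv (f.parent_mem v w hw).1,
      Option.eq_none_iff_forall_not_mem.2 fun w hw => hv (f.mate_mem v w hw)⟩
  refine LabForest.ext (Finset.union_comm _ _) (funext fun v => ?_) (funext fun v => ?_) <;>
  · simp only [concat]
    split_ifs with h1 h2 h2
    · exact absurd h2 (Finset.disjoint_left.1 h h1)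
    · rfl
    · rfl
    · simp [hn f v h1, hn g v h2]

/-- A forest on `W` split by `S` is the same as a pair of forests on `S` and `W \ S`, by restriction
and concatenation. -/
lemma sum_withVerts_splittings (F G : LabForest → ℝ) (W : Finset ℕ) :
    ∑ f ∈ withVerts W, ∑ S ∈ f.splittings, F (f.restrict S) * G (f.restrict (f.verts \ S)) =
      ∑ S ∈ W.powerset, (∑ f ∈ withVerts S, F f) * ∑ g ∈ withVerts (W \ S), G g := by
  classical
  rw [Finset.sum_comm' (t' := W.powerset) (s' := fun S => (withVerts W).filter fun f => f.Splits S)]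
  · refine Finset.sum_congr rfl fun S hS => ?_
    rw [Finset.mem_powerset] at hS
    rw [Finset.sum_mul_sum, ← Finset.sum_product']
    refine Finset.sum_nbij (fun f => (f.restrict S, f.restrict (W \ S))) ?_ ?_ ?_ ?_
    · intro f hf
      rw [Finset.mem_filter, mem_withVerts] at hf
      rw [Finset.mem_product, mem_withVerts, mem_withVerts]
      simp only [restrict, hf.1]
      exact ⟨Finset.inter_eq_right.2 hS, Finset.inter_eq_right.2 Finset.sdiff_subset⟩
    · intro f hf g hg e
      rw [Finset.mem_coe, Finset.mem_filter, mem_withVerts] at hf hg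
      obtain ⟨e1, e2⟩ := Prod.ext_iff.1 e
      dsimp only at e1 e2
      have hu := Finset.union_sdiff_of_subset hS
      rw [← concat_restrict Finset.disjoint_sdiff (hu.trans hf.1.symm) hf.2 (hf.1 ▸ hf.2.compl),
        ← concat_restrict Finset.disjoint_sdiff (hu.trans hg.1.symm) hg.2 (hg.1 ▸ hg.2.compl)]
      congr 1
    · rintro ⟨f, g⟩ hfg
      rw [Finset.mem_coe, Finset.mem_product, mem_withVerts, mem_withVerts] at hfg
      obtain ⟨rfl, hg⟩ := hfg
      dsimp only at hg hS
      have hd : Disjoint f.verts g.verts := hg ▸ Finset.disjoint_sdiff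
      refine ⟨f.concat g hd, ?_, ?_⟩
      · rw [Finset.mem_coe, Finset.mem_filter, mem_withVerts]
        refine ⟨?_, splits_concat hd⟩
        change f.verts ∪ g.verts = W
        rw [hg, Finset.union_sdiff_of_subset hS]
      · dsimp only
        rw [restrict_concat_left, ← hg, concat_comm, restrict_concat_left]
    · intro f hf
      rw [Finset.mem_filter, mem_withVerts] at hf
      rw [hf.1]
  · intro f S
    rw [Finset.mem_filter, mem_withVerts, mem_splittings, Finset.mem_powerset]
    constructor
    · rintro ⟨rfl, h1, h2⟩
      exact ⟨⟨rfl, h2⟩, h1⟩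
    · rintro ⟨⟨rfl, h2⟩, h1⟩
      exact ⟨rfl, h1, h2⟩

/-- The exponential generating series of the sums over all forests with `n` vertices. -/
noncomputable def egf (F : LabForest → ℝ) (n : ℕ) : ℝ :=
  (∑ f ∈ withVerts (Finset.range n), F f) / n.factorial

/-- By invariance the summand for `S` depends only on its cardinality, and the binomial coefficient
is absorbed by the factorials. -/
lemma egf_eq_sum_range {E F G : LabForest → ℝ} (hF : Invariant F) (hG : Invariant G)
    (h : ∀ f : LabForest,
      E f = ∑ S ∈ f.splittings, F (f.restrict S) * G (f.restrict (f.verts \ S))) (n : ℕ) :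
    egf E n = ∑ m ∈ Finset.range (n + 1), egf F m * egf G (n - m) := by
  have hS : ∀ S ∈ (Finset.range n).powerset,
      (∑ f ∈ withVerts S, F f) * ∑ g ∈ withVerts (Finset.range n \ S), G g =
        (fun m => (∑ f ∈ withVerts (Finset.range m), F f) *
          ∑ g ∈ withVerts (Finset.range (n - m)), G g) S.card := by
    intro S hS
    dsimp only
    rw [hF.sum_withVerts (W := S) (W' := Finset.range S.card) (by simp),
      hG.sum_withVerts (W := Finset.range n \ S) (W' := Finset.range (n - S.card))]
    rw [Finset.card_sdiff_of_subset (Finset.mem_powerset.1 hS), Finset.card_range,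
      Finset.card_range]
  rw [egf, Finset.sum_congr rfl fun f _ => h f, sum_withVerts_splittings, Finset.sum_congr rfl hS,
    Finset.sum_powerset_apply_card fun m => (∑ f ∈ withVerts (Finset.range m), F f) *
      ∑ g ∈ withVerts (Finset.range (n - m)), G g, Finset.card_range, Finset.sum_div]
  refine Finset.sum_congr rfl fun m hm => ?_
  have hm' : m ≤ n := Nat.lt_succ_iff.1 (Finset.mem_range.1 hm)
  rw [nsmul_eq_mul, Nat.cast_choose ℝ hm', egf, egf]
  have h1 : (n.factorial : ℝ) ≠ 0 := by positivity
  have h2 : (m.factorial : ℝ) ≠ 0 := by positivity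
  have h3 : ((n - m).factorial : ℝ) ≠ 0 := by positivity
  field_simp

end LabForest

/-! ### The order-condition map as a value of a generating series. -/

open LabForest

/-- A rooted forest as an exotic forest. -/
def LabForest.Rooted.toExotic {f : LabForest} (h : f.Rooted) : LabExoticForest := ⟨f, h⟩

namespace ExoticForest

lemma forget_eq_iff {f g : LabExoticForest} : forget f = forget g ↔ ∃ φ, IsIso f.1 g.1 φ :=
  Quotient.eq

lemma symmetry_forget (f : LabExoticForest) : symmetry (forget f) = isoCard f.1 f.1 := rfl

lemma isoCard_of_forget_eq {f g : LabExoticForest} (h : forget f = forget g) :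
    isoCard f.1 g.1 = symmetry (forget f) := by
  obtain ⟨φ, hφ⟩ := forget_eq_iff.1 h
  rw [symmetry_forget, isoCard_congr (IsIso.refl f.1) hφ.symm]

lemma symmetry_pos (π : ExoticForest) : 0 < symmetry π := by
  obtain ⟨f, rfl⟩ := Quotient.exists_rep π
  exact isoCard_self_pos f.1

/-- The function `a`, extended by `0`, as a function of labelled forests. -/
noncomputable def onLab (a : ExoticForest → ℝ) (f : LabForest) : ℝ :=
  open Classical in if h : f.Rooted then a (forget h.toExotic) else 0

lemma onLab_apply (a : ExoticForest → ℝ) (f : LabExoticForest) : onLab a f.1 = a (forget f) :=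
  dif_pos f.2

lemma onLab_invariant (a : ExoticForest → ℝ) : Invariant (onLab a) := by
  rintro f g ⟨φ, hφ⟩
  by_cases hf : f.Rooted
  · have hg := hφ.isoOn.rooted_iff.1 hf
    have he : forget hf.toExotic = forget hg.toExotic := forget_eq_iff.2 ⟨φ, hφ⟩
    rw [onLab, onLab, dif_pos hf, dif_pos hg, he]
  · rw [onLab, onLab, dif_neg hf, dif_neg (mt hφ.isoOn.rooted_iff.2 hf)]

/-- The product is defined through even and odd labels, but any disjoint representatives give the
same class. -/
lemma onLab_concat {a : ExoticForest → ℝ} (ha : IsCharacter a) {f g : LabForest} (hf : f.Rooted)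
    (hg : g.Rooted) (h : Disjoint f.verts g.verts) :
    onLab a (f.concat g h) = onLab a f * onLab a g := by
  change onLab a (hf.concat hg h).toExotic.1 = onLab a hf.toExotic.1 * onLab a hg.toExotic.1
  rw [onLab_apply, onLab_apply, onLab_apply, ← ha.map_mul]
  congr 1
  exact forget_eq_iff.2 (exists_isIso_concat (exists_isIso_relabel _ _ _ _)
    (exists_isIso_relabel _ _ _ _) h (disjoint_relabel f g))

/-- The sum of `C(f → g)` over all chains starting at `f`, where every `g` counts with the number
of isomorphisms from `p` to `g`. -/
noncomputable def isoSum (O : VertexOrder) (p f : LabForest) : ℝ :=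
  chainSum O (fun g => (isoCard p g : ℝ)) f

variable {O : VertexOrder} {p : LabForest}

lemma isoSum_eq_zero (hp : p.Rooted) {f : LabForest} (hf : ¬ f.Rooted) : isoSum O p f = 0 :=
  chainSum_eq_zero (fun g hg => by rw [isoCard_eq_zero_of_not_rooted hp hg, Nat.cast_zero]) hf

lemma isoSum_invariant (hp : p.Rooted) : Invariant (isoSum O p) := fun _ _ h =>
  chainSum_congr O (fun g hg => by rw [isoCard_eq_zero_of_not_rooted hp hg, Nat.cast_zero])
    (fun _ _ ⟨_, hφ⟩ => by rw [isoCard_congr (IsIso.refl p) hφ]) h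

lemma isoSum_congr {q : LabForest} (h : ∃ φ, IsIso p q φ) : isoSum O p = isoSum O q := by
  obtain ⟨φ, hφ⟩ := h
  funext f
  simp only [isoSum, isoCard_congr hφ (IsIso.refl _)]

lemma isoSum_eq_zero_of_card {f : LabForest} (h : 2 * p.verts.card < f.verts.card) :
    isoSum O p f = 0 := by
  refine finsum_eq_zero_of_forall_eq_zero fun x => ?_
  dsimp only
  rw [isoCard_eq_zero, Nat.cast_zero, zero_mul]
  rintro ⟨φ, hφ⟩
  have := x.2.card_le
  have := hφ.isoOn.card_eq
  omega

lemma isoSum_concat {q : LabForest} (hp : p.Rooted) (hq : q.Rooted)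
    (h : Disjoint p.verts q.verts) (f : LabForest) :
    isoSum O (p.concat q h) f = ∑ S ∈ f.splittings,
      isoSum O p (f.restrict S) * isoSum O q (f.restrict (f.verts \ S)) := by
  refine chainSum_eq_sum_splittings O ?_ ?_ (fun f => ?_) f
  · exact fun g hg => by rw [isoCard_eq_zero_of_not_rooted hp hg, Nat.cast_zero]
  · exact fun g hg => by rw [isoCard_eq_zero_of_not_rooted hq hg, Nat.cast_zero]
  · rw [isoCard_concat]
    push_cast
    rfl

lemma chainSum_eq_finsum (u : LabForest → ℝ) (f : LabForest) :
    chainSum O u f = ∑ᶠ g, u g * ∑ᶠ c : LTC O f g, c.coeff := by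
  classical
  have hfin : ∀ g, Finite (LTC O f g) := fun g =>
    Finite.of_injective (fun c => (⟨g, c⟩ : Σ g, LTC O f g)) sigma_mk_injective
  have := fun g => Fintype.ofFinite (LTC O f g)
  have := Fintype.ofFinite (Σ g, LTC O f g)
  let s : Finset LabForest := Finset.univ.image (Sigma.fst : (Σ g, LTC O f g) → LabForest)
  have hs : (Finset.univ : Finset (Σ g, LTC O f g)) = s.sigma fun _ => Finset.univ := by
    ext x
    simp only [Finset.mem_univ, Finset.mem_sigma, and_true, true_iff]
    exact Finset.mem_image_of_mem _ (Finset.mem_univ _)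
  rw [chainSum, finsum_eq_sum_of_fintype, hs, Finset.sum_sigma,
    finsum_eq_sum_of_support_subset (s := s)]
  · refine Finset.sum_congr rfl fun g _ => ?_
    rw [finsum_eq_sum_of_fintype, Finset.mul_sum]
  · intro g hg
    by_contra hgs
    have : IsEmpty (LTC O f g) :=
      ⟨fun c => hgs (Finset.mem_image.2 ⟨⟨g, c⟩, Finset.mem_univ _, rfl⟩)⟩
    exact hg (by simp only [finsum_of_isEmpty, mul_zero])

/-- A forest isomorphic to `p` receives as many isomorphisms from `p` as `p` has automorphisms, any
other receives none. The factor `σ` thus replaces the restriction to one class. -/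
lemma symmetry_mul_coeffA (Ψ : ExoticForest → LabExoticForest) (p : LabExoticForest)
    (π₀ : ExoticForest) :
    (symmetry (forget p) : ℝ) * coeffA O Ψ π₀ (forget p) = isoSum O p.1 (Ψ π₀).1 := by
  rw [isoSum, chainSum_eq_finsum, coeffA, ← smul_eq_mul, smul_finsum]
  let ι : {g : LabExoticForest // forget g = forget p} → LabForest := fun g => g.1.1
  have hι : Function.Injective ι := Subtype.val_injective.comp Subtype.val_injective
  set F : LabForest → ℝ := fun g => (isoCard p.1 g : ℝ) * ∑ᶠ c : LTC O (Ψ π₀).1 g, c.coeff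
  have h1 : ∑ᶠ g, F g = ∑ᶠ g ∈ Set.range ι, F g := by
    rw [← finsum_mem_univ]
    refine finsum_mem_inter_support_eq' _ _ _ fun g hg => iff_of_true trivial ?_
    have hiso : ∃ φ, IsIso p.1 g φ := by
      by_contra hno
      exact hg (by simp only [F, isoCard_eq_zero hno, Nat.cast_zero, zero_mul])
    have hgr : g.Rooted := hiso.elim fun φ hφ => hφ.isoOn.rooted_iff.1 p.2
    exact ⟨⟨hgr.toExotic, (forget_eq_iff.2 hiso).symm⟩, rfl⟩
  rw [h1, finsum_mem_range hι]
  refine finsum_congr fun g => ?_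
  rw [smul_eq_mul, coeffAL]
  simp only [F, ι]
  rw [isoCard_of_forget_eq g.2.symm]

lemma finite_setOf_card_le (Ψ : ExoticForest → LabExoticForest)
    (hΨ : ∀ π : ExoticForest, forget (Ψ π) = π) (N : ℕ) :
    {π₀ : ExoticForest | (Ψ π₀).1.verts.card ≤ N}.Finite := by
  classical
  refine Set.Finite.subset (Finset.finite_toSet (((Finset.range (N + 1)).biUnion fun n =>
    withVerts (Finset.range n)).image fun f => if h : f.Rooted then forget h.toExotic else 1)) ?_
  intro π₀ hπ
  obtain ⟨σ, hσ⟩ := exists_perm_image_eq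
    (s := (Ψ π₀).1.verts) (t := Finset.range (Ψ π₀).1.verts.card) (by simp)
  have hi := isoOn_relabel (Ψ π₀).1 σ
  have hr := hi.rooted_iff.1 (Ψ π₀).2
  rw [Finset.mem_coe, Finset.mem_image]
  refine ⟨(Ψ π₀).1.relabel σ σ.symm σ.symm_apply_apply, Finset.mem_biUnion.2
    ⟨_, Finset.mem_range.2 (Nat.lt_succ_of_le hπ), mem_withVerts.2 hσ⟩, ?_⟩
  rw [dif_pos hr]
  exact (forget_eq_iff.2 ⟨_, hi.isIso⟩).symm.trans (hΨ π₀)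

/-- A class with `n` vertices has `n!/σ` labellings by the numbers below `n`. -/
lemma finsum_div_symmetry (Ψ : ExoticForest → LabExoticForest)
    (hΨ : ∀ π : ExoticForest, forget (Ψ π) = π) {F : LabForest → ℝ} (hF : Invariant F)
    (h₀ : ∀ f : LabForest, ¬ f.Rooted → F f = 0) {N : ℕ}
    (hN : ∀ f : LabForest, N < f.verts.card → F f = 0) :
    ∑ᶠ π₀ : ExoticForest, F (Ψ π₀).1 / symmetry π₀ = ∑ n ∈ Finset.range (N + 1), egf F n := by
  classical
  set C := (finite_setOf_card_le Ψ hΨ N).toFinset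
  have hmem : ∀ π₀, π₀ ∈ C ↔ (Ψ π₀).1.verts.card ≤ N := fun π₀ => Set.Finite.mem_toFinset _
  rw [finsum_eq_sum_of_support_subset (s := C), ← Finset.sum_fiberwise_of_maps_to
    (t := Finset.range (N + 1)) (g := fun π₀ => (Ψ π₀).1.verts.card)]
  · refine Finset.sum_congr rfl fun n hn => ?_
    have hn : n ≤ N := Nat.lt_succ_iff.1 (Finset.mem_range.1 hn)
    -- Only the class of `f` contributes, and there the number of isomorphisms cancels `σ`.
    -- Summation over `f` then gives `n!` by `sum_isoCard`.
    have key : ∀ f ∈ withVerts (Finset.range n),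
        F f = ∑ π₀ ∈ C with (Ψ π₀).1.verts.card = n,
          F (Ψ π₀).1 / symmetry π₀ * isoCard (Ψ π₀).1 f := by
      intro f hf
      rw [mem_withVerts] at hf
      by_cases hr : f.Rooted
      · have he := hΨ (forget hr.toExotic)
        obtain ⟨φ, hφ⟩ := forget_eq_iff.1 he
        have hcard : (Ψ (forget hr.toExotic)).1.verts.card = n := by
          rw [hφ.isoOn.card_eq]
          exact (congrArg Finset.card hf).trans (Finset.card_range n)
        rw [Finset.sum_eq_single (forget hr.toExotic)]
        · have h2 := isoCard_of_forget_eq he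
          rw [he] at h2
          change isoCard _ f = _ at h2
          have := symmetry_pos (forget hr.toExotic)
          rw [h2, div_mul_cancel₀ _ (by positivity)]
          exact (hF _ _ ⟨φ, hφ⟩).symm
        · intro π₀ _ hne
          rw [isoCard_eq_zero, Nat.cast_zero, mul_zero]
          intro hiso
          exact hne ((hΨ π₀).symm.trans (forget_eq_iff (g := hr.toExotic).2 hiso))
        · intro hno
          exact absurd (Finset.mem_filter.2 ⟨(hmem _).2 (hcard.trans_le hn), hcard⟩) hno
      · rw [h₀ f hr, Finset.sum_eq_zero]
        intro π₀ _
        rw [isoCard_eq_zero_of_not_rooted (Ψ π₀).2 hr, Nat.cast_zero, mul_zero]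
    rw [egf, Finset.sum_congr rfl key, Finset.sum_comm, Finset.sum_div]
    refine Finset.sum_congr rfl fun π₀ hπ => ?_
    rw [Finset.mem_filter] at hπ
    rw [← Finset.mul_sum, ← Nat.cast_sum,
      sum_isoCard (Ψ π₀).1 (by rw [hπ.2, Finset.card_range]), Finset.card_range,
      mul_div_cancel_right₀ _ (by positivity)]
  · exact fun π₀ hπ => Finset.mem_range.2 (Nat.lt_succ_of_le ((hmem π₀).1 hπ))
  · intro π₀ hπ
    by_contra hno
    rw [Finset.mem_coe, hmem, not_le] at hno
    exact hπ (by simp only [hN _ hno, zero_div])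

/-- The terms of `ω`, as a function of labelled forests. -/
noncomputable def omegaTerm (O : VertexOrder) (a : ExoticForest → ℝ) (p f : LabForest) : ℝ :=
  onLab a f * isoSum O p f

lemma omegaTerm_invariant (a : ExoticForest → ℝ) (hp : p.Rooted) :
    Invariant (omegaTerm O a p) := fun f g h => by
  rw [omegaTerm, omegaTerm, onLab_invariant a f g h, isoSum_invariant hp f g h]

lemma omegaTerm_eq_zero_of_card (a : ExoticForest → ℝ) {f : LabForest}
    (h : 2 * p.verts.card < f.verts.card) : omegaTerm O a p f = 0 := by
  rw [omegaTerm, isoSum_eq_zero_of_card h, mul_zero]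

lemma egf_omegaTerm_eq_zero (a : ExoticForest → ℝ) {n : ℕ} (h : 2 * p.verts.card < n) :
    egf (omegaTerm O a p) n = 0 := by
  rw [egf, Finset.sum_eq_zero, zero_div]
  intro f hf
  rw [mem_withVerts] at hf
  exact omegaTerm_eq_zero_of_card a (by rwa [hf, Finset.card_range])

lemma omega_eq_sum (Ψ : ExoticForest → LabExoticForest)
    (hΨ : ∀ π : ExoticForest, forget (Ψ π) = π) (a : ExoticForest → ℝ) (p : LabExoticForest) :
    omega O Ψ a (forget p) =
      ∑ n ∈ Finset.range (2 * p.1.verts.card + 1), egf (omegaTerm O a p.1) n := by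
  rw [← finsum_div_symmetry Ψ hΨ (omegaTerm_invariant a p.2)
    (fun f hf => by rw [omegaTerm, isoSum_eq_zero p.2 hf, mul_zero])
    (fun f hf => omegaTerm_eq_zero_of_card a hf), omega, ← smul_eq_mul, smul_finsum]
  refine finsum_congr fun π₀ => ?_
  rw [omegaTerm, ← symmetry_mul_coeffA, onLab_apply, hΨ, smul_eq_mul]
  ring

/-- As an infinite series, `ω` no longer shows a cutoff that depends on `p`, and the Cauchy product
applies directly. -/
lemma omega_eq_tsum (Ψ : ExoticForest → LabExoticForest)
    (hΨ : ∀ π : ExoticForest, forget (Ψ π) = π) (a : ExoticForest → ℝ) (p : LabExoticForest) :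
    omega O Ψ a (forget p) = ∑' n, egf (omegaTerm O a p.1) n := by
  rw [omega_eq_sum Ψ hΨ, tsum_eq_sum]
  intro n hn
  exact egf_omegaTerm_eq_zero a (by simpa using hn)

lemma summable_norm_egf_omegaTerm (a : ExoticForest → ℝ) :
    Summable fun n => ‖egf (omegaTerm O a p) n‖ := by
  refine summable_of_ne_finset_zero (s := Finset.range (2 * p.verts.card + 1)) fun n hn => ?_
  rw [egf_omegaTerm_eq_zero a (by simpa using hn), norm_zero]

/-- If both parts are rooted, `a` is multiplicative over the splitting; otherwise the `isoSum` of an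
unrooted part is zero. -/
lemma omegaTerm_concat {a : ExoticForest → ℝ} (ha : IsCharacter a) {q : LabForest} (hp : p.Rooted)
    (hq : q.Rooted) (h : Disjoint p.verts q.verts) (f : LabForest) :
    omegaTerm O a (p.concat q h) f = ∑ S ∈ f.splittings,
      omegaTerm O a p (f.restrict S) * omegaTerm O a q (f.restrict (f.verts \ S)) := by
  rw [omegaTerm, isoSum_concat hp hq, Finset.mul_sum]
  refine Finset.sum_congr rfl fun S hS => ?_
  obtain ⟨hSV, hS⟩ := mem_splittings.1 hS
  rw [omegaTerm, omegaTerm]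
  by_cases h1 : (f.restrict S).Rooted
  · by_cases h2 : (f.restrict (f.verts \ S)).Rooted
    · have he := concat_restrict Finset.disjoint_sdiff (Finset.union_sdiff_of_subset hSV) hS
        hS.compl
      have := onLab_concat ha h1 h2 (restrict_disjoint Finset.disjoint_sdiff)
      rw [he] at this
      rw [this]
      ring
    · rw [isoSum_eq_zero hq h2]
      ring
  · rw [isoSum_eq_zero hp h1]
    ring

lemma forget_mul (p q : LabExoticForest) : forget p * forget q =
    forget ((p.2.relabel _ _ _).concat (q.2.relabel _ _ _)
      (disjoint_relabel p.1 q.1)).toExotic := rfl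

lemma omega_mul (Ψ : ExoticForest → LabExoticForest)
    (hΨ : ∀ π : ExoticForest, forget (Ψ π) = π) {a : ExoticForest → ℝ} (ha : IsCharacter a)
    (π₁ π₂ : ExoticForest) :
    omega O Ψ a (π₁ * π₂) = omega O Ψ a π₁ * omega O Ψ a π₂ := by
  obtain ⟨p, rfl⟩ : ∃ p, forget p = π₁ := ⟨_, hΨ π₁⟩
  obtain ⟨q, rfl⟩ : ∃ q, forget q = π₂ := ⟨_, hΨ π₂⟩
  rw [forget_mul, omega_eq_tsum Ψ hΨ, omega_eq_tsum Ψ hΨ, omega_eq_tsum Ψ hΨ,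
    tsum_mul_tsum_eq_tsum_sum_range_of_summable_norm (summable_norm_egf_omegaTerm a)
      (summable_norm_egf_omegaTerm a)]
  refine tsum_congr fun n => egf_eq_sum_range (omegaTerm_invariant a p.2)
    (omegaTerm_invariant a q.2) (fun f => ?_) n
  -- The product uses relabelled copies of `p` and `q`, which the terms do not notice.
  have hp' : omegaTerm O a p.1 = omegaTerm O a
      (p.1.relabel (fun n => 2 * n) (fun n => n / 2) (fun n => by omega)) := by
    funext f
    rw [omegaTerm, omegaTerm, isoSum_congr (exists_isIso_relabel _ _ _ _)]
  have hq' : omegaTerm O a q.1 = omegaTerm O a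
      (q.1.relabel (fun n => 2 * n + 1) (fun n => n / 2) (fun n => by omega)) := by
    funext f
    rw [omegaTerm, omegaTerm, isoSum_congr (exists_isIso_relabel _ _ _ _)]
  rw [hp', hq']
  exact omegaTerm_concat ha (p.2.relabel _ _ _) (q.2.relabel _ _ _) (disjoint_relabel p.1 q.1) f

lemma omega_one (Ψ : ExoticForest → LabExoticForest)
    (hΨ : ∀ π : ExoticForest, forget (Ψ π) = π) {a : ExoticForest → ℝ} (ha : a 1 = 1) :
    omega O Ψ a 1 = 1 := by
  have hw : withVerts (Finset.range 0) = {LabForest.empty} := by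
    ext f
    rw [mem_withVerts, Finset.mem_singleton]
    constructor
    · intro hf
      have hno : ∀ v, v ∉ f.verts := fun v => by simp [hf]
      refine LabForest.ext hf (funext fun v => ?_) (funext fun v => ?_)
      · exact Option.eq_none_iff_forall_not_mem.2 fun w hw => hno v (f.parent_mem v w hw).1
      · exact Option.eq_none_iff_forall_not_mem.2 fun w hw => hno v (f.mate_mem v w hw)
    · rintro rfl
      rfl
  have hs : isoCard LabForest.empty LabForest.empty = 1 := by
    have : IsEmpty (LabForest.empty.verts) := ⟨fun v => by simpa [LabForest.empty] using v.2⟩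
    have : Unique {e : LabForest.empty.verts ≃ LabForest.empty.verts //
        IsIso LabForest.empty LabForest.empty e} :=
      { default := ⟨_, IsIso.refl _⟩
        uniq := fun _ => Subsingleton.elim _ _ }
    exact Nat.card_unique
  change omega O Ψ a (forget Rooted.empty.toExotic) = 1
  rw [omega_eq_sum Ψ hΨ]
  have hc : 2 * Rooted.empty.toExotic.1.verts.card + 1 = 1 := rfl
  have ha' : onLab a LabForest.empty = 1 := (onLab_apply a Rooted.empty.toExotic).trans ha
  have ho : isoSum O Rooted.empty.toExotic.1 LabForest.empty = 1 := by
    change isoSum O LabForest.empty LabForest.empty = 1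
    rw [isoSum, chainSum_done fun v w h => by simpa [LabForest.empty] using h.1, hs, Nat.cast_one]
  rw [hc, Finset.sum_range_one, egf, hw, Finset.sum_singleton, omegaTerm, ha', ho]
  simp

end ExoticForest

/-- Multiplicative property of order conditions: the order-condition map `ω` obtained from a
character `a` is again a character (the sums that define `ω` being finite), so that the condition
on a concatenated forest follows from the condition on a factor. -/
theorem theorem2 (O : VertexOrder) (Ψ : ExoticForest → LabExoticForest)
    (hΨ : ∀ π : ExoticForest, ExoticForest.forget (Ψ π) = π)
    (a : ExoticForest → ℝ) (ha : ExoticForest.IsCharacter a) :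
    (∀ f : LabExoticForest, Finite (Σ g : LabForest, LTC O f.1 g)) ∧
    (∀ π : ExoticForest, {π₀ : ExoticForest | ExoticForest.coeffA O Ψ π₀ π ≠ 0}.Finite) ∧
    ExoticForest.IsCharacter (ExoticForest.omega O Ψ a) ∧
    (∀ π₁ π₂ : ExoticForest, ExoticForest.omega O Ψ a π₁ = 0 ∨ ExoticForest.omega O Ψ a π₂ = 0 →
      ExoticForest.omega O Ψ a (π₁ * π₂) = 0) := by
  refine ⟨fun f => LTC.finite_chains O f.1, fun π => ?_,
    ⟨ExoticForest.omega_one Ψ hΨ ha.map_one, ExoticForest.omega_mul Ψ hΨ ha⟩, fun π₁ π₂ h => ?_⟩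
  · obtain ⟨p, rfl⟩ : ∃ p, ExoticForest.forget p = π := ⟨_, hΨ π⟩
    refine (ExoticForest.finite_setOf_card_le Ψ hΨ (2 * p.1.verts.card)).subset fun π₀ hπ => ?_
    by_contra hlt
    rw [Set.mem_ofPred_eq, not_le] at hlt
    have hz := ExoticForest.symmetry_mul_coeffA (O := O) Ψ p π₀
    rw [ExoticForest.isoSum_eq_zero_of_card hlt] at hz
    -- Since `σ` is positive, the vanishing of `isoSum` for large `π₀` passes to the coefficient.
    have hpos := ExoticForest.symmetry_pos (ExoticForest.forget p)
    exact hπ ((mul_eq_zero.1 hz).resolve_left (by positivity))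
  · rw [ExoticForest.omega_mul Ψ hΨ ha]
    exact mul_eq_zero.2 h
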